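/- Let $d\ge 1$, let $f$ be a probability density on $\mathbb{R}^d$ with $\int f^5<\infty$, and let $r_n\ge 0$ satisfy $r_n\to 0$ and $n^{3/2}r_n^d\to\infty$. For each $n$ let $X_1,\dots,X_n$ be i.i.d. with density $f$, and let $G_n$ be the graph on $n$ vertices in which distinct vertices $u,v$ are adjacent if and only if $\|X_u-X_v\|\le r_n$ (Euclidean norm). Label the vertices by $1,\dots,n$ by a random labelling independent of the $X_u$ (for example a uniformly random one, or the original one), and let $\xi_{ij}$ be the indicator that the vertices labelled $i$ and $j$ are adjacent. Put $$W_2=\frac{\sum_{i<j<k}\xi_{ki}\xi_{kj}\xi_{ij}}{\sum_{i<j<k}\xi_{ki}\xi_{kj}}$$ (with any fixed value, say $0$, when the denominator vanishes), and let $w_d=\mathbb{P}\{\|Y-Z\|\le 1\}$, where $Y,Z$ are independent and uniformly distributed in the unit ball of $\mathbb{R}^d$. Then $W_2\to w_d$ in probability as $n\to\infty$. Moreover, if $\Delta_n$ is a function of the labelled graph alone (not of $d$, $f$ or $r_n$) that equals a minimizer of $|W_2-w_k|$ over the integers $k\ge 1$ whenever a minimizer exists (ties broken arbitrarily, arbitrary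 value if there is no minimizer), then $\Delta_n\to d$ in probability as $n\to\infty$. -/

import Mathlib

open MeasureTheory ProbabilityTheory Filter Topology

noncomputable section

/-- The random geometric graph on the points `x i`: distinct `i`, `j` are joined
when the Euclidean distance of `x i` and `x j` is at most `r`. -/
def geomGraph {d n : ℕ} (r : ℝ) (x : Fin n → EuclideanSpace ℝ (Fin d)) :
    SimpleGraph (Fin n) where
  Adj i j := i ≠ j ∧ dist (x i) (x j) ≤ r
  symm := ⟨fun i j h => ⟨h.1.symm, by rw [dist_comm]; exact h.2⟩⟩
  loopless := ⟨fun _ h => h.1 rfl⟩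

/-- The uniform distribution on the unit ball of `ℝ^d`. -/
def unifBall (d : ℕ) : Measure (EuclideanSpace ℝ (Fin d)) :=
  ProbabilityTheory.cond volume (Metric.closedBall 0 1)

/-- `w_d = P(‖X - Y‖ ≤ 1)` for independent `X`, `Y` uniform on the unit ball of `ℝ^d`. -/
def ballConst (d : ℕ) : ℝ :=
  ((unifBall d).prod (unifBall d)).real {p | ‖p.1 - p.2‖ ≤ 1}

open Classical in
/-- The edge indicator `ξ_{ij}`. -/
def edgeInd {n : ℕ} (G : SimpleGraph (Fin n)) (i j : Fin n) : ℝ :=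
  if G.Adj i j then 1 else 0

/-- The global ratio `W₂`: both sums run over all triples `i < j < k`.
(The value is `0` when the denominator vanishes.) -/
def globalRatio {n : ℕ} (G : SimpleGraph (Fin n)) : ℝ :=
  (∑ i : Fin n, ∑ j ∈ Finset.Ioi i, ∑ k ∈ Finset.Ioi j,
      edgeInd G k i * edgeInd G k j * edgeInd G i j) /
    (∑ i : Fin n, ∑ j ∈ Finset.Ioi i, ∑ k ∈ Finset.Ioi j,
      edgeInd G k i * edgeInd G k j)

/-- `k` is a minimizer of `|W - w_k|` among the dimensions `k ≥ 1`. -/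
def IsDimArgmin (W : ℝ) (k : ℕ) : Prop :=
  1 ≤ k ∧ ∀ m : ℕ, 1 ≤ m → |W - ballConst k| ≤ |W - ballConst m|

/-- `Δ` is the estimator `argmin_k |W₂ - w_k|`: a function of the graph alone, whose value is
a minimizer whenever there is one. Ties are broken arbitrarily, and the value is arbitrary
if the infimum is not attained (as for `W₂ = 0`). -/
def IsArgminDimEstimator (Δ : (n : ℕ) → SimpleGraph (Fin n) → ℕ) : Prop :=
  ∀ (n : ℕ) (G : SimpleGraph (Fin n)),
    (∃ k, IsDimArgmin (globalRatio G) k) → IsDimArgmin (globalRatio G) (Δ n G)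

/-- Such estimators exist. -/
theorem exists_isArgminDimEstimator :
    ∃ Δ : (n : ℕ) → SimpleGraph (Fin n) → ℕ, IsArgminDimEstimator Δ := by
  classical
  refine ⟨fun n G => if h : ∃ k, IsDimArgmin (globalRatio G) k then h.choose else 0, ?_⟩
  intro n G h
  simp only [dif_pos h]
  exact h.choose_spec

end

/-! The numerator and the denominator of `W₂` are both of the form `tripleSum`: they count the
triples `i < j < k` for which `x i - x k` and `x j - x k`, divided by `r`, form a pair in a fixed
bounded set `S` (`globalRatio_geomGraph`). Write `ρ = r ^ d`. A change of variables and the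
continuity of translations in `L³` show that a given triple is counted with probability `ρ² (|S| ∫
f³ + o(1))` (`tendsto_prod_prod_withDensity_scaled`).

For the variance, disjoint triples are uncorrelated. Two triples that meet and cover `m ∈ {3, 4, 5}`
vertices force a star with `m - 1` edges of length at most `2r`, an event of probability `O(ρ^(m-1)
∫ f^m)`; the case `m = 5` is where the fifth moment enters. As there are `O(n^m)` such pairs, the
variance is `O(n³ρ² + n⁴ρ³ + n⁵ρ⁴)`, which is negligible against the squared mean, of order `n⁶ρ⁴`,
because `n^(3/2) ρ → ∞`. Chebyshev's inequality gives a weak law for each sum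
(`tendsto_pi_tripleSum`). In the ratio the positive factor `∫ f³` cancels, and the quotient of the
two volumes is `w_d`.

Consistency of the estimator then rests on strict monotonicity of `w_d` in `d`
(`ballConst_succ_lt`), which isolates `w_d` from all other `w_k`. Sorting the sides of the triangle
`0, y, z` by length, then rotating and rescaling its longest side, gives `w_d = 3κ/V`, where `V` is
the volume of the unit ball and `κ` that of its cap beyond height `1/2` (`volume_equilateral`).
Slicing turns this into a quotient of integrals of `(1 - x²)^((d-1)/2)`; raising `d` multiplies the
integrand by `√(1 - x²)`, which moves mass away from the cap. -/

open scoped ENNReal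

/-! ### Volume of the pairs spanning a triangle with all sides at most one. -/

section TriangleVolume

variable {E : Type*} [NormedAddCommGroup E] [InnerProductSpace ℝ E] [FiniteDimensional ℝ E]
  [MeasurableSpace E] [BorelSpace E]

/-- Together with `volume_shear_norms` this generates all permutations of the three side lengths of
the triangle `0, y, z`. -/
theorem volume_swap_norms (φ : ℝ → ℝ → ℝ → Prop)
    (hφ : MeasurableSet {t : ℝ × ℝ × ℝ | φ t.1 t.2.1 t.2.2}) :
    volume {p : E × E | φ ‖p.2‖ ‖p.1‖ ‖p.1 - p.2‖} =
      volume {p : E × E | φ ‖p.1‖ ‖p.2‖ ‖p.1 - p.2‖} := by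
  have hm : MeasurableSet {p : E × E | φ ‖p.1‖ ‖p.2‖ ‖p.1 - p.2‖} :=
    hφ.preimage (f := fun p : E × E => (‖p.1‖, ‖p.2‖, ‖p.1 - p.2‖)) (by fun_prop)
  have h := (Measure.measurePreserving_swap (μ := (volume : Measure E))
    (ν := (volume : Measure E))).measure_preimage hm.nullMeasurableSet
  simp only [Set.preimage_ofPred_eq, Prod.fst_swap, Prod.snd_swap] at h
  rw [Measure.volume_eq_prod, ← h]
  simp only [norm_sub_rev]

theorem measurePreserving_prodMk_sub :
    MeasurePreserving (fun p : E × E => (p.1, p.1 - p.2)) volume volume :=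
  (MeasurePreserving.id (volume : Measure E)).skew_product
    (g := fun y z : E => y - z) (by fun_prop)
    (Eventually.of_forall fun y => (Measure.measurePreserving_sub_left (volume : Measure E) y).map_eq)

theorem volume_shear_norms (φ : ℝ → ℝ → ℝ → Prop)
    (hφ : MeasurableSet {t : ℝ × ℝ × ℝ | φ t.1 t.2.1 t.2.2}) :
    volume {p : E × E | φ ‖p.1‖ ‖p.1 - p.2‖ ‖p.2‖} =
      volume {p : E × E | φ ‖p.1‖ ‖p.2‖ ‖p.1 - p.2‖} := by
  have hm : MeasurableSet {p : E × E | φ ‖p.1‖ ‖p.2‖ ‖p.1 - p.2‖} :=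
    hφ.preimage (f := fun p : E × E => (‖p.1‖, ‖p.2‖, ‖p.1 - p.2‖)) (by fun_prop)
  rw [← measurePreserving_prodMk_sub.measure_preimage hm.nullMeasurableSet]
  simp

/-- Fubini: for fixed `y` the exceptional `z` form a sphere, which is null; nontriviality covers
radius zero. -/
theorem ae_norm_fst_ne_norm_snd [Nontrivial E] :
    ∀ᵐ p : E × E, ‖p.1‖ ≠ ‖p.2‖ := by
  have hm : MeasurableSet {p : E × E | ‖p.1‖ ≠ ‖p.2‖} :=
    (measurableSet_eq_fun (f := fun p : E × E => ‖p.1‖) (g := fun p : E × E => ‖p.2‖)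
      (by fun_prop) (by fun_prop)).compl
  refine (Measure.ae_prod_iff_ae_ae hm).2 (Eventually.of_forall fun y => ?_)
  have := Measure.addHaar_sphere (volume : Measure E) 0 ‖y‖
  rw [measure_eq_zero_iff_ae_notMem] at this
  filter_upwards [this] with z hz h
  exact hz (by simpa using h.symm)

theorem ae_norms_pairwise_ne [Nontrivial E] :
    ∀ᵐ p : E × E, ‖p.1‖ ≠ ‖p.2‖ ∧ ‖p.1‖ ≠ ‖p.1 - p.2‖ ∧ ‖p.2‖ ≠ ‖p.1 - p.2‖ := by
  have h1 := ae_norm_fst_ne_norm_snd (E := E)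
  have h2 : ∀ᵐ p : E × E, ‖p.1‖ ≠ ‖p.1 - p.2‖ :=
    measurePreserving_prodMk_sub.quasiMeasurePreserving.ae h1
  have h3 : ∀ᵐ p : E × E, ‖p.2‖ ≠ ‖p.2 - p.1‖ :=
    (Measure.measurePreserving_swap (μ := (volume : Measure E))
      (ν := (volume : Measure E))).quasiMeasurePreserving.ae h2
  filter_upwards [h1, h2, h3] with p h1 h2 h3
  exact ⟨h1, h2, by rwa [norm_sub_rev p.1]⟩

theorem measurableSet_norms (φ : ℝ → ℝ → ℝ → Prop)
    (hφ : MeasurableSet {t : ℝ × ℝ × ℝ | φ t.1 t.2.1 t.2.2}) :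
    MeasurableSet {p : E × E | φ ‖p.1‖ ‖p.2‖ ‖p.1 - p.2‖} :=
  hφ.preimage (f := fun p : E × E => (‖p.1‖, ‖p.2‖, ‖p.1 - p.2‖)) (by fun_prop)

theorem longest_cases {a b c : ℝ} (h : a ≠ b ∧ a ≠ c ∧ b ≠ c) :
    (a ≤ 1 ∧ b ≤ 1 ∧ c ≤ 1) ↔
      ((b < a ∧ c < a ∧ a ≤ 1) ∨ (a < b ∧ c < b ∧ b ≤ 1)) ∨ (a < c ∧ b < c ∧ c ≤ 1) := by
  grind

/-- Almost every triangle has a unique longest side, and by symmetry each of the three sides is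
equally likely to be it. -/
theorem volume_equilateral_eq_three_mul [Nontrivial E] :
    volume {p : E × E | ‖p.1‖ ≤ 1 ∧ ‖p.2‖ ≤ 1 ∧ ‖p.1 - p.2‖ ≤ 1} =
      3 * volume {p : E × E | ‖p.2‖ < ‖p.1‖ ∧ ‖p.1 - p.2‖ < ‖p.1‖ ∧ ‖p.1‖ ≤ 1} := by
  set φ : ℝ → ℝ → ℝ → Prop := fun a b c => b < a ∧ c < a ∧ a ≤ 1 with hφdef
  have hφ : MeasurableSet {t : ℝ × ℝ × ℝ | φ t.1 t.2.1 t.2.2} := by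
    simp only [hφdef]; measurability
  have hφ2 : MeasurableSet {t : ℝ × ℝ × ℝ | φ t.2.1 t.1 t.2.2} := by
    simp only [hφdef]; measurability
  have e2 := volume_swap_norms (E := E) φ hφ
  have e3 := volume_shear_norms (E := E) (fun a b c => φ b a c) hφ2
  have hA : {p : E × E | ‖p.1‖ ≤ 1 ∧ ‖p.2‖ ≤ 1 ∧ ‖p.1 - p.2‖ ≤ 1} =ᵐ[volume]
      ({p : E × E | φ ‖p.1‖ ‖p.2‖ ‖p.1 - p.2‖} ∪ {p : E × E | φ ‖p.2‖ ‖p.1‖ ‖p.1 - p.2‖} ∪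
        {p : E × E | φ ‖p.1 - p.2‖ ‖p.1‖ ‖p.2‖} : Set (E × E)) := by
    filter_upwards [ae_norms_pairwise_ne (E := E)] with p hp
    exact propext (longest_cases hp)
  have m1 := measurableSet_norms (E := E) φ hφ
  have m2 := measurableSet_norms (E := E) (fun a b c => φ b a c) (by
    simp only [hφdef]; measurability)
  have m3 := measurableSet_norms (E := E) (fun a b c => φ c a b) (by
    simp only [hφdef]; measurability)
  rw [measure_congr hA, measure_union _ m3, measure_union _ m2, e3, e2]
  · ring
  · rw [Set.disjoint_left]; rintro p ⟨h1, h2, h3⟩ ⟨h4, h5, h6⟩; linarith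
  · rw [Set.disjoint_left]; rintro p (⟨h1, h2, h3⟩ | ⟨h1, h2, h3⟩) ⟨h4, h5, h6⟩ <;> linarith

theorem volume_longest_eq_two_mul [Nontrivial E] :
    volume {p : E × E | ‖p.2‖ < ‖p.1‖ ∧ ‖p.1 - p.2‖ < ‖p.1‖ ∧ ‖p.1‖ ≤ 1} =
      2 * volume {p : E × E | ‖p.1 - p.2‖ < ‖p.2‖ ∧ ‖p.2‖ < ‖p.1‖ ∧ ‖p.1‖ ≤ 1} := by
  set φ : ℝ → ℝ → ℝ → Prop := fun a b c => c < b ∧ b < a ∧ a ≤ 1 with hφdef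
  have hφ : MeasurableSet {t : ℝ × ℝ × ℝ | φ t.1 t.2.1 t.2.2} := by
    simp only [hφdef]; measurability
  have e3 := volume_shear_norms (E := E) φ hφ
  have hA : {p : E × E | ‖p.2‖ < ‖p.1‖ ∧ ‖p.1 - p.2‖ < ‖p.1‖ ∧ ‖p.1‖ ≤ 1} =ᵐ[volume]
      ({p : E × E | φ ‖p.1‖ ‖p.2‖ ‖p.1 - p.2‖} ∪
        {p : E × E | φ ‖p.1‖ ‖p.1 - p.2‖ ‖p.2‖} : Set (E × E)) := by
    filter_upwards [ae_norms_pairwise_ne (E := E)] with p hp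
    refine propext ?_
    change (_ ∧ _ ∧ _) ↔ ((_ ∧ _ ∧ _) ∨ (_ ∧ _ ∧ _))
    obtain ⟨h1, h2, h3⟩ := hp
    clear * - h1 h2 h3
    grind
  have m3 := measurableSet_norms (E := E) (fun a b c => φ a c b) (by
    simp only [hφdef]; measurability)
  rw [measure_congr hA, measure_union _ m3, e3]
  · ring
  · rw [Set.disjoint_left]; rintro p ⟨h1, h2, h3⟩ ⟨h4, h5, h6⟩; linarith

theorem volume_closedBall_sq_eq_two_mul [Nontrivial E] :
    volume (Metric.closedBall (0 : E) 1) * volume (Metric.closedBall (0 : E) 1) =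
      2 * volume {p : E × E | ‖p.2‖ < ‖p.1‖ ∧ ‖p.1‖ ≤ 1} := by
  set φ : ℝ → ℝ → ℝ → Prop := fun a b _ => b < a ∧ a ≤ 1 with hφdef
  have hφ : MeasurableSet {t : ℝ × ℝ × ℝ | φ t.1 t.2.1 t.2.2} := by
    simp only [hφdef]; measurability
  have e3 := volume_swap_norms (E := E) φ hφ
  have hA : (Metric.closedBall (0 : E) 1 ×ˢ Metric.closedBall (0 : E) 1 : Set (E × E))
      =ᵐ[volume] ({p : E × E | φ ‖p.1‖ ‖p.2‖ ‖p.1 - p.2‖} ∪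
        {p : E × E | φ ‖p.2‖ ‖p.1‖ ‖p.1 - p.2‖} : Set (E × E)) := by
    filter_upwards [ae_norms_pairwise_ne (E := E)] with p hp
    refine propext ?_
    change (p.1 ∈ Metric.closedBall (0 : E) 1 ∧ p.2 ∈ Metric.closedBall (0 : E) 1) ↔
      ((_ ∧ _) ∨ (_ ∧ _))
    rw [mem_closedBall_zero_iff, mem_closedBall_zero_iff]
    obtain ⟨h1, h2, h3⟩ := hp
    clear * - h1 h2 h3
    grind
  have m3 := measurableSet_norms (E := E) (fun a b c => φ b a c) (by
    simp only [hφdef]; measurability)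
  rw [← Measure.prod_prod, ← Measure.volume_eq_prod, measure_congr hA, measure_union _ m3, e3]
  · ring
  · rw [Set.disjoint_left]; rintro p ⟨h1, h2⟩ ⟨h4, h5⟩; linarith

/-- A reflection carries `e` to the direction of `y`, and scaling by `‖y‖` does the rest; so the
slice over `y` depends on `y` only through a power of its norm. -/
theorem volume_slice_eq {e y : E} (he : ‖e‖ = 1) (hy : y ≠ 0) :
    volume {z : E | ‖y - z‖ < ‖z‖ ∧ ‖z‖ < ‖y‖} =
      ENNReal.ofReal (‖y‖ ^ Module.finrank ℝ E) * volume {z : E | ‖e - z‖ < ‖z‖ ∧ ‖z‖ < 1} := by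
  have hy0 : 0 < ‖y‖ := norm_pos_iff.2 hy
  obtain ⟨ρ, hρ⟩ : ∃ ρ : E ≃ₗᵢ[ℝ] E, ρ e = ‖y‖⁻¹ • y :=
    ⟨_, Submodule.reflection_sub (v := e) (w := ‖y‖⁻¹ • y) (by
      rw [he, norm_smul, norm_inv, norm_norm, inv_mul_cancel₀ hy0.ne'])⟩
  have hset : {z : E | ‖y - z‖ < ‖z‖ ∧ ‖z‖ < ‖y‖} =
      (fun z => ‖y‖⁻¹ • z) ⁻¹' (ρ.symm ⁻¹' {z : E | ‖e - z‖ < ‖z‖ ∧ ‖z‖ < 1}) := by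
    ext z
    have h1 : ‖e - ρ.symm (‖y‖⁻¹ • z)‖ = ‖y‖⁻¹ * ‖y - z‖ := by
      rw [← ρ.norm_map, map_sub, ρ.apply_symm_apply, hρ, ← smul_sub, norm_smul, norm_inv,
        norm_norm]
    have h2 : ‖ρ.symm (‖y‖⁻¹ • z)‖ = ‖y‖⁻¹ * ‖z‖ := by
      rw [ρ.symm.norm_map, norm_smul, norm_inv, norm_norm]
    simp only [Set.mem_ofPred_eq, Set.mem_preimage, h1, h2]
    rw [mul_lt_mul_iff_right₀ (inv_pos.2 hy0), inv_mul_lt_one₀ hy0]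
  have hm : MeasurableSet {z : E | ‖e - z‖ < ‖z‖ ∧ ‖z‖ < 1} :=
    (measurableSet_lt (f := fun z : E => ‖e - z‖) (g := fun z : E => ‖z‖)
      (by fun_prop) (by fun_prop)).inter
      (measurableSet_lt (f := fun z : E => ‖z‖) (by fun_prop) measurable_const)
  rw [hset, Measure.addHaar_preimage_smul _ (inv_ne_zero hy0.ne'),
    ρ.symm.measurePreserving.measure_preimage hm.nullMeasurableSet, inv_pow, inv_inv,
    abs_of_pos (by positivity)]

theorem volume_equilateral [Nontrivial E] {e : E} (he : ‖e‖ = 1) :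
    volume {p : E × E | ‖p.1‖ ≤ 1 ∧ ‖p.2‖ ≤ 1 ∧ ‖p.1 - p.2‖ ≤ 1} =
      3 * volume {z : E | ‖e - z‖ < ‖z‖ ∧ ‖z‖ < 1} * volume (Metric.closedBall (0 : E) 1) := by
  set V := volume (Metric.closedBall (0 : E) 1) with hV
  set κ := volume {z : E | ‖e - z‖ < ‖z‖ ∧ ‖z‖ < 1} with hκ
  set I := ∫⁻ y in Metric.closedBall (0 : E) 1, ENNReal.ofReal (‖y‖ ^ Module.finrank ℝ E) with hI
  have hV0 : V ≠ 0 := (Metric.measure_closedBall_pos volume 0 one_pos).ne'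
  have hVt : V ≠ ∞ := measure_closedBall_lt_top.ne
  have hκt : κ ≠ ∞ := by
    refine ne_top_of_le_ne_top hVt (measure_mono fun z hz => ?_)
    simpa using hz.2.le
  have hmeas : Measurable fun y : E => ENNReal.ofReal (‖y‖ ^ Module.finrank ℝ E) := by fun_prop
  have hC : volume {p : E × E | ‖p.1 - p.2‖ < ‖p.2‖ ∧ ‖p.2‖ < ‖p.1‖ ∧ ‖p.1‖ ≤ 1} = I * κ := by
    have hm := measurableSet_norms (E := E) (fun a b c => c < b ∧ b < a ∧ a ≤ 1) (by measurability)
    rw [Measure.volume_eq_prod, Measure.prod_apply hm, hI, ← lintegral_mul_const _ hmeas,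
      ← lintegral_indicator measurableSet_closedBall]
    refine lintegral_congr_ae ?_
    have h0 : ∀ᵐ y : E, y ≠ 0 := Measure.ae_ne volume 0
    filter_upwards [h0] with y hy
    by_cases h : y ∈ Metric.closedBall (0 : E) 1
    · rw [Set.indicator_of_mem h, ← volume_slice_eq he hy]
      rw [mem_closedBall_zero_iff] at h
      congr 1; ext z; simp [h]
    · rw [Set.indicator_of_notMem h]
      rw [mem_closedBall_zero_iff] at h
      convert measure_empty (μ := (volume : Measure E)) using 2
      ext z; simp [h]
  have hD : volume {p : E × E | ‖p.2‖ < ‖p.1‖ ∧ ‖p.1‖ ≤ 1} = I * V := by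
    have hm := measurableSet_norms (E := E) (fun a b c => b < a ∧ a ≤ 1) (by measurability)
    rw [Measure.volume_eq_prod, Measure.prod_apply hm, hI, ← lintegral_mul_const _ hmeas,
      ← lintegral_indicator measurableSet_closedBall]
    refine lintegral_congr fun y => ?_
    by_cases h : y ∈ Metric.closedBall (0 : E) 1
    · rw [Set.indicator_of_mem h, hV, Measure.addHaar_closedBall_eq_addHaar_ball,
        ← Measure.addHaar_ball volume (0 : E) (norm_nonneg y)]
      rw [mem_closedBall_zero_iff] at h
      congr 1; ext z; simp [h]
    · rw [Set.indicator_of_notMem h]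
      rw [mem_closedBall_zero_iff] at h
      convert measure_empty (μ := (volume : Measure E)) using 2
      ext z; simp [h]
  have hVV := volume_closedBall_sq_eq_two_mul (E := E)
  rw [hD, ← hV, ← mul_assoc] at hVV
  -- Computing `V * V` by ordering the two norms yields the value of the radial integral `I` without
  -- polar coordinates.
  have h2I : V = 2 * I := (ENNReal.mul_left_inj hV0 hVt).1 hVV
  rw [volume_equilateral_eq_three_mul, volume_longest_eq_two_mul, hC, h2I]
  ring

end TriangleVolume

/-! ### The constants `w_d` as quotients of one-dimensional integrals, and their monotonicity. -/

section BallSlices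

/-- The Euclidean vector with first coordinate `p.1` and remaining coordinates `p.2`. -/
def consEuclidean (n : ℕ) (p : ℝ × EuclideanSpace ℝ (Fin n)) : EuclideanSpace ℝ (Fin (n + 1)) :=
  WithLp.toLp 2 (Fin.cons p.1 (WithLp.ofLp p.2))

theorem measurePreserving_consEuclidean (n : ℕ) :
    MeasurePreserving (consEuclidean n) volume volume := by
  have h1 : MeasurePreserving
      (Prod.map id (WithLp.ofLp : EuclideanSpace ℝ (Fin n) → Fin n → ℝ)) volume volume :=
    (MeasurePreserving.id (volume : Measure ℝ)).prod (PiLp.volume_preserving_ofLp (Fin n))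
  have h2 := (volume_preserving_piFinSuccAbove (fun _ : Fin (n + 1) => ℝ) 0).symm
  have h3 := PiLp.volume_preserving_toLp (Fin (n + 1))
  have := h3.comp (h2.comp h1)
  have heq : consEuclidean n = WithLp.toLp 2 ∘
      (MeasurableEquiv.piFinSuccAbove (fun _ : Fin (n + 1) => ℝ) 0).symm ∘
        Prod.map id WithLp.ofLp := by
    funext p
    simp [consEuclidean, MeasurableEquiv.piFinSuccAbove, Function.comp_def, Fin.insertNthEquiv]
  rw [heq]
  exact this

theorem norm_sq_consEuclidean (n : ℕ) (p : ℝ × EuclideanSpace ℝ (Fin n)) :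
    ‖consEuclidean n p‖ ^ 2 = p.1 ^ 2 + ‖p.2‖ ^ 2 := by
  simp [EuclideanSpace.norm_sq_eq, consEuclidean, Fin.sum_univ_succ]

/-- Fubini in the first coordinate: the slice at height `x` is a ball of radius `√(1 - x ^ 2)` in
one dimension less. The volume of the lower-dimensional unit ball is left as a factor, since it
cancels in `ballConst_succ`. -/
theorem volume_ball_inter_slab (n : ℕ) {I : Set ℝ} (hI : MeasurableSet I)
    (hI1 : I ⊆ Set.Ioo (-1) 1) :
    volume {z : EuclideanSpace ℝ (Fin (n + 1)) | ‖z‖ < 1 ∧ z 0 ∈ I} =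
      volume (Metric.ball (0 : EuclideanSpace ℝ (Fin n)) 1) *
        ∫⁻ x in I, ENNReal.ofReal (√(1 - x ^ 2) ^ n) := by
  have hm : MeasurableSet {z : EuclideanSpace ℝ (Fin (n + 1)) | ‖z‖ < 1 ∧ z 0 ∈ I} :=
    (measurableSet_lt (f := fun z : EuclideanSpace ℝ (Fin (n + 1)) => ‖z‖) (by fun_prop)
      measurable_const).inter
      (hI.preimage (f := fun z : EuclideanSpace ℝ (Fin (n + 1)) => z 0) (by fun_prop))
  rw [← (measurePreserving_consEuclidean n).measure_preimage hm.nullMeasurableSet,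
    Measure.volume_eq_prod,
    Measure.prod_apply (hm.preimage (measurePreserving_consEuclidean n).measurable),
    ← lintegral_const_mul _ (by fun_prop), ← lintegral_indicator hI]
  refine lintegral_congr fun x => ?_
  by_cases hx : x ∈ I
  · rw [Set.indicator_of_mem hx]
    have hx1 : 0 < 1 - x ^ 2 := by
      have := hI1 hx
      nlinarith [this.1, this.2]
    have hset : Prod.mk x ⁻¹' (consEuclidean n ⁻¹'
        {z : EuclideanSpace ℝ (Fin (n + 1)) | ‖z‖ < 1 ∧ z 0 ∈ I}) =
        Metric.ball (0 : EuclideanSpace ℝ (Fin n)) √(1 - x ^ 2) := by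
      ext t
      have h0 : (consEuclidean n (x, t)) 0 = x := by simp [consEuclidean]
      simp only [Set.mem_preimage, Set.mem_ofPred_eq, h0, hx, and_true, mem_ball_zero_iff]
      rw [Real.lt_sqrt (norm_nonneg _), ← sq_lt_one_iff₀ (norm_nonneg _), norm_sq_consEuclidean]
      constructor <;> intro h <;> simp only at h ⊢ <;> linarith
    rw [hset, Measure.addHaar_ball_of_pos _ _ (Real.sqrt_pos.2 hx1), finrank_euclideanSpace_fin,
      mul_comm]
  · rw [Set.indicator_of_notMem hx]
    convert measure_empty (μ := (volume : Measure (EuclideanSpace ℝ (Fin n)))) using 2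
    ext t
    have h0 : (consEuclidean n (x, t)) 0 = x := by simp [consEuclidean]
    simp [h0, hx]

theorem continuous_sqrt_one_sub_sq_pow (n : ℕ) :
    Continuous fun x : ℝ => √(1 - x ^ 2) ^ n := by fun_prop

theorem setLIntegral_sqrt_one_sub_sq_pow (n : ℕ) {a b : ℝ} (hab : a ≤ b) :
    ∫⁻ x in Set.Ioo a b, ENNReal.ofReal (√(1 - x ^ 2) ^ n) =
      ENNReal.ofReal (∫ x in a..b, √(1 - x ^ 2) ^ n) := by
  rw [intervalIntegral.integral_of_le hab, integral_Ioc_eq_integral_Ioo,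
    ofReal_integral_eq_lintegral_ofReal]
  · exact ((continuous_sqrt_one_sub_sq_pow n).integrableOn_Icc (a := a) (b := b)).mono_set
      Set.Ioo_subset_Icc_self
  · exact Eventually.of_forall fun x => by positivity

theorem ballConst_eq (d : ℕ) :
    ballConst d = ((volume (Metric.closedBall (0 : EuclideanSpace ℝ (Fin d)) 1))⁻¹ *
      ((volume (Metric.closedBall (0 : EuclideanSpace ℝ (Fin d)) 1))⁻¹ *
        volume {p : EuclideanSpace ℝ (Fin d) × EuclideanSpace ℝ (Fin d) |
          ‖p.1‖ ≤ 1 ∧ ‖p.2‖ ≤ 1 ∧ ‖p.1 - p.2‖ ≤ 1})).toReal := by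
  let E := EuclideanSpace ℝ (Fin d)
  have hms : MeasurableSet {p : E × E | ‖p.1 - p.2‖ ≤ 1} :=
    measurableSet_le (f := fun p : E × E => ‖p.1 - p.2‖) (by fun_prop) measurable_const
  rw [ballConst, measureReal_def, unifBall, ProbabilityTheory.cond,
    Measure.prod_smul_left, Measure.prod_smul_right, Measure.smul_apply, Measure.smul_apply,
    Measure.prod_restrict, Measure.restrict_apply hms, smul_eq_mul, smul_eq_mul,
    ← Measure.volume_eq_prod]
  congr 4
  ext p
  simp only [Set.mem_inter_iff, Set.mem_ofPred_eq, Set.mem_prod, mem_closedBall_zero_iff]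
  exact ⟨fun h => ⟨h.2.1, h.2.2, h.1⟩, fun h => ⟨h.2.2, h.1, h.2.1⟩⟩

theorem ballConst_succ (n : ℕ) :
    ballConst (n + 1) = 3 / 2 * ((∫ x in (1 / 2 : ℝ)..1, √(1 - x ^ 2) ^ n) /
      ((∫ x in (0 : ℝ)..(1 / 2), √(1 - x ^ 2) ^ n) +
        ∫ x in (1 / 2 : ℝ)..1, √(1 - x ^ 2) ^ n)) := by
  set a := ∫ x in (1 / 2 : ℝ)..1, √(1 - x ^ 2) ^ n with ha
  set b := ∫ x in (0 : ℝ)..(1 / 2), √(1 - x ^ 2) ^ n with hb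
  let E := EuclideanSpace ℝ (Fin (n + 1))
  have hint : ∀ u v : ℝ, IntervalIntegrable (fun x : ℝ => √(1 - x ^ 2) ^ n) volume u v :=
    fun u v => (continuous_sqrt_one_sub_sq_pow n).intervalIntegrable u v
  have hab : ∫ x in (-1 : ℝ)..1, √(1 - x ^ 2) ^ n = 2 * (b + a) := by
    have h1 : ∫ x in (-1 : ℝ)..0, √(1 - x ^ 2) ^ n = ∫ x in (0 : ℝ)..1, √(1 - x ^ 2) ^ n := by
      have := intervalIntegral.integral_comp_neg (a := (-1 : ℝ)) (b := 0)
        (fun x : ℝ => √(1 - x ^ 2) ^ n)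
      simpa using this
    rw [← intervalIntegral.integral_add_adjacent_intervals (hint (-1) 0) (hint 0 1), h1,
      ← intervalIntegral.integral_add_adjacent_intervals (hint 0 (1 / 2)) (hint (1 / 2) 1)]
    ring
  set v := volume (Metric.ball (0 : EuclideanSpace ℝ (Fin n)) 1) with hv
  have hball : volume (Metric.closedBall (0 : E) 1) = v * ENNReal.ofReal (2 * (b + a)) := by
    rw [Measure.addHaar_closedBall_eq_addHaar_ball, ← hab,
      ← setLIntegral_sqrt_one_sub_sq_pow n (by norm_num),
      ← volume_ball_inter_slab n measurableSet_Ioo subset_rfl]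
    congr 1
    ext z
    rw [mem_ball_zero_iff]
    refine ⟨fun h => ⟨h, abs_lt.1 (lt_of_le_of_lt ?_ h)⟩, fun h => h.1⟩
    simpa using PiLp.norm_apply_le z 0
  have hcap : volume {z : E | ‖EuclideanSpace.single 0 1 - z‖ < ‖z‖ ∧ ‖z‖ < 1} =
      v * ENNReal.ofReal a := by
    rw [ha, ← setLIntegral_sqrt_one_sub_sq_pow n (by norm_num),
      ← volume_ball_inter_slab n measurableSet_Ioo (Set.Ioo_subset_Ioo (by norm_num) le_rfl)]
    congr 1
    ext z
    -- Being nearer to the pole than to the origin is a half-space condition, so `κ` is the volume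
    -- of a cap.
    have h1 : ‖EuclideanSpace.single (0 : Fin (n + 1)) (1 : ℝ) - z‖ < ‖z‖ ↔ 1 / 2 < z 0 := by
      rw [← sq_lt_sq₀ (norm_nonneg _) (norm_nonneg _), @norm_sub_sq_real]
      simp only [PiLp.norm_single, EuclideanSpace.inner_single_left]
      constructor <;> intro h <;> simp at h ⊢ <;> linarith
    simp only [Set.mem_ofPred_eq, h1, Set.mem_Ioo]
    constructor
    · rintro ⟨h2, h3⟩
      refine ⟨h3, h2, lt_of_le_of_lt ?_ h3⟩
      exact (le_abs_self _).trans (by simpa using PiLp.norm_apply_le z 0)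
    · rintro ⟨h2, h3, -⟩
      exact ⟨h3, h2⟩
  have he : ‖(EuclideanSpace.single 0 1 : E)‖ = 1 := by simp
  have htri := volume_equilateral he
  rw [hcap, hball] at htri
  have ha0 : 0 ≤ a := intervalIntegral.integral_nonneg (by norm_num) fun x _ => by positivity
  have hb0 : 0 ≤ b := intervalIntegral.integral_nonneg (by norm_num) fun x _ => by positivity
  have hV0 : volume (Metric.closedBall (0 : E) 1) ≠ 0 :=
    (Metric.measure_closedBall_pos volume 0 one_pos).ne'
  have hvt : v ≠ ∞ := measure_ball_lt_top.ne
  rw [ballConst_eq, htri, hball]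
  rw [hball] at hV0
  have hv0 : v.toReal ≠ 0 := fun h => hV0 (by
    rcases (ENNReal.toReal_eq_zero_iff _).1 h with h | h
    · rw [h, zero_mul]
    · exact absurd h hvt)
  have hba : 0 < b + a := by
    by_contra hcon
    exact hV0 (by rw [ENNReal.ofReal_of_nonpos (by linarith), mul_zero])
  simp only [ENNReal.toReal_mul, ENNReal.toReal_inv, ENNReal.toReal_ofReal ha0,
    ENNReal.toReal_ofReal (show 0 ≤ 2 * (b + a) by positivity), ENNReal.toReal_ofNat]
  field_simp

/-- The extra factor `√(1 - x ^ 2)` is at most its value `s` at `1 / 2` on the cap side and at least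
`s` on the other, strictly at `0`; hence the cap's share of the total integral drops. -/
theorem ballConst_succ_lt (n : ℕ) : ballConst (n + 2) < ballConst (n + 1) := by
  rw [ballConst_succ, ballConst_succ]
  have hint : ∀ (m : ℕ) (u v : ℝ), IntervalIntegrable (fun x : ℝ => √(1 - x ^ 2) ^ m) volume u v :=
    fun m u v => (continuous_sqrt_one_sub_sq_pow m).intervalIntegrable u v
  set s : ℝ := √(1 - (1 / 2) ^ 2) with hs
  have hs0 : 0 < s := Real.sqrt_pos.2 (by norm_num)
  have ha : 0 < ∫ x in (1 / 2 : ℝ)..1, √(1 - x ^ 2) ^ n := by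
    refine intervalIntegral.intervalIntegral_pos_of_pos_on (hint _ _ _) (fun x hx => ?_)
      (by norm_num)
    have : 0 < 1 - x ^ 2 := by nlinarith [hx.1, hx.2]
    positivity
  have hb : 0 < ∫ x in (0 : ℝ)..(1 / 2), √(1 - x ^ 2) ^ n := by
    refine intervalIntegral.intervalIntegral_pos_of_pos_on (hint _ _ _) (fun x hx => ?_)
      (by norm_num)
    have : 0 < 1 - x ^ 2 := by nlinarith [hx.1, hx.2]
    positivity
  have ha' : ∫ x in (1 / 2 : ℝ)..1, √(1 - x ^ 2) ^ (n + 1) ≤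
      s * ∫ x in (1 / 2 : ℝ)..1, √(1 - x ^ 2) ^ n := by
    rw [← intervalIntegral.integral_const_mul]
    refine intervalIntegral.integral_mono_on (by norm_num) (hint _ _ _)
      ((hint _ _ _).const_mul _) fun x hx => ?_
    rw [pow_succ, mul_comm]
    refine mul_le_mul_of_nonneg_right (Real.sqrt_le_sqrt ?_) (by positivity)
    nlinarith [hx.1, hx.2]
  have hb' : s * ∫ x in (0 : ℝ)..(1 / 2), √(1 - x ^ 2) ^ n <
      ∫ x in (0 : ℝ)..(1 / 2), √(1 - x ^ 2) ^ (n + 1) := by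
    rw [← intervalIntegral.integral_const_mul]
    refine intervalIntegral.integral_lt_integral_of_continuousOn_of_le_of_exists_lt
      (by norm_num) (by fun_prop) (by fun_prop) (fun x hx => ?_) ⟨0, by norm_num, ?_⟩
    · rw [pow_succ (√(1 - x ^ 2)), mul_comm _ (√(1 - x ^ 2))]
      refine mul_le_mul_of_nonneg_right (Real.sqrt_le_sqrt ?_) (by positivity)
      nlinarith [hx.1, hx.2]
    · have : s < 1 := by
        rw [hs, Real.sqrt_lt' one_pos]; norm_num
      simpa using this
  have ha'' : 0 ≤ ∫ x in (1 / 2 : ℝ)..1, √(1 - x ^ 2) ^ (n + 1) :=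
    intervalIntegral.integral_nonneg (by norm_num) fun x _ => by positivity
  generalize (∫ x in (1 / 2 : ℝ)..1, √(1 - x ^ 2) ^ (n + 1)) = a' at *
  generalize (∫ x in (0 : ℝ)..(1 / 2), √(1 - x ^ 2) ^ (n + 1)) = b' at *
  generalize (∫ x in (1 / 2 : ℝ)..1, √(1 - x ^ 2) ^ n) = a at *
  generalize (∫ x in (0 : ℝ)..(1 / 2), √(1 - x ^ 2) ^ n) = b at *
  have hb0 : 0 < b' := lt_trans (by positivity) hb'
  refine mul_lt_mul_of_pos_left ?_ (by norm_num)
  rw [div_lt_div_iff₀ (by positivity) (by positivity)]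
  have h1 : a' * b ≤ s * a * b := mul_le_mul_of_nonneg_right ha' hb.le
  have h2 : a * (s * b) < a * b' := mul_lt_mul_of_pos_left hb' ha
  nlinarith

theorem ballConst_lt_of_lt {k m : ℕ} (hk : 1 ≤ k) (hkm : k < m) : ballConst m < ballConst k := by
  have h : StrictAnti fun n : ℕ => ballConst (n + 1) := strictAnti_nat_of_succ_lt ballConst_succ_lt
  have := @h (k - 1) (m - 1) (by omega)
  simpa [Nat.sub_add_cancel hk, Nat.sub_add_cancel (hk.trans hkm.le)] using this

/-- By monotonicity only the neighbours `d + 1` and, if `d > 1`, `d - 1` matter. -/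
theorem exists_ballConst_gap {d : ℕ} (hd : 1 ≤ d) :
    ∃ γ : ℝ, 0 < γ ∧ ∀ m, 1 ≤ m → m ≠ d → γ ≤ |ballConst m - ballConst d| := by
  have hup : ∀ m, d < m → ballConst d - ballConst (d + 1) ≤ |ballConst m - ballConst d| := by
    intro m hm
    have h1 : ballConst m ≤ ballConst (d + 1) := by
      rcases (Nat.succ_le_of_lt hm).eq_or_lt with h | h
      · rw [← h]
      · exact (ballConst_lt_of_lt (by omega) h).le
    have h2 := ballConst_lt_of_lt hd (Nat.lt_succ_self d)
    rw [abs_sub_comm]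
    exact le_trans (by linarith) (le_abs_self _)
  have hpos : 0 < ballConst d - ballConst (d + 1) :=
    sub_pos.2 (ballConst_lt_of_lt hd (Nat.lt_succ_self d))
  rcases hd.eq_or_lt with rfl | hd2
  · exact ⟨_, hpos, fun m hm hmd => hup m (by omega)⟩
  · refine ⟨min (ballConst d - ballConst (d + 1)) (ballConst (d - 1) - ballConst d),
      lt_min hpos (sub_pos.2 (ballConst_lt_of_lt (by omega) (by omega))), fun m hm hmd => ?_⟩
    rcases lt_or_gt_of_ne hmd with h | h
    · have h1 : ballConst (d - 1) ≤ ballConst m := by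
        rcases (Nat.le_sub_one_of_lt h).eq_or_lt with h | h
        · rw [h]
        · exact (ballConst_lt_of_lt hm h).le
      exact (min_le_right _ _).trans (le_trans (by linarith) (le_abs_self _))
    · exact (min_le_left _ _).trans (hup m h)

/-- Within half the gap of `w_d` the minimizer exists and is unique, so neither ties nor missing
minimizers can affect the limit. -/
theorem exists_forall_isDimArgmin_iff {d : ℕ} (hd : 1 ≤ d) :
    ∃ ε : ℝ, 0 < ε ∧ ∀ W : ℝ, |W - ballConst d| < ε → ∀ k, IsDimArgmin W k ↔ k = d := by
  obtain ⟨γ, hγ, h⟩ := exists_ballConst_gap hd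
  refine ⟨γ / 2, by positivity, fun W hW => ?_⟩
  have key : ∀ m, 1 ≤ m → m ≠ d → |W - ballConst d| < |W - ballConst m| := by
    intro m hm hmd
    have h1 := h m hm hmd
    have h2 := abs_sub_le (ballConst m) W (ballConst d)
    rw [abs_sub_comm (ballConst m) W] at h2
    linarith
  intro k
  constructor
  · rintro ⟨hk, hmin⟩
    by_contra hkd
    exact absurd (hmin d hd) (not_le.2 (key k hk hkd))
  · rintro rfl
    refine ⟨hd, fun m hm => ?_⟩
    rcases eq_or_ne m k with rfl | hmk
    · exact le_rfl
    · exact (key m hm hmk).le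

end BallSlices

/-! ### Products of translates and continuity of translation in `L³`. -/

section Translates

variable {E : Type*} [NormedAddCommGroup E] [InnerProductSpace ℝ E] [FiniteDimensional ℝ E]
  [MeasurableSpace E] [BorelSpace E]

/-- A weighted substitute for Hölder's inequality, by comparing `z` with `δ * max x y`. The large
coefficient falls on `z`, which will be the difference of a translate and the function itself. -/
theorem mul_mul_le_add_cubes {x y z δ : ℝ} (hx : 0 ≤ x) (hy : 0 ≤ y) (hz : 0 ≤ z) (hδ : 0 < δ) :
    x * y * z ≤ δ * (x ^ 3 + y ^ 3) + δ⁻¹ ^ 2 * z ^ 3 := by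
  set m := max x y with hm
  have hm0 : 0 ≤ m := hx.trans (le_max_left _ _)
  have hxy : x * y ≤ m * m := mul_le_mul (le_max_left _ _) (le_max_right _ _) hy hm0
  have hm3 : m ^ 3 ≤ x ^ 3 + y ^ 3 := by
    rcases max_choice x y with h | h <;> rw [hm, h]
    · linarith [pow_nonneg hy 3]
    · linarith [pow_nonneg hx 3]
  rcases le_or_gt z (δ * m) with h | h
  · calc x * y * z ≤ m * m * (δ * m) := mul_le_mul hxy h hz (by positivity)
      _ = δ * m ^ 3 := by ring
      _ ≤ δ * (x ^ 3 + y ^ 3) := by gcongr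
      _ ≤ _ := le_add_of_nonneg_right (by positivity)
  · have h1 : m ≤ δ⁻¹ * z := by
      rw [inv_mul_eq_div, le_div_iff₀ hδ]; linarith
    calc x * y * z ≤ (δ⁻¹ * z) * (δ⁻¹ * z) * z := by
          refine mul_le_mul_of_nonneg_right (hxy.trans ?_) hz
          exact mul_le_mul h1 h1 hm0 (by positivity)
      _ = δ⁻¹ ^ 2 * z ^ 3 := by ring
      _ ≤ _ := le_add_of_nonneg_left (by positivity)

theorem memLp_three_of_integrable {f : E → ℝ} (hm : Measurable f) (h0 : ∀ x, 0 ≤ f x)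
    (hf : Integrable (fun x => f x ^ 3) volume) : MemLp f 3 volume := by
  refine (integrable_norm_rpow_iff hm.aestronglyMeasurable (by norm_num) (by norm_num)).1 ?_
  refine hf.congr (Eventually.of_forall fun x => ?_)
  simp only [Real.norm_of_nonneg (h0 x), ENNReal.toReal_ofNat]
  norm_cast

theorem integral_abs_cube_eq {g : E → ℝ} (hg : MemLp g 3 volume) :
    ∫ x, |g x| ^ 3 = (eLpNorm g 3 volume).toReal ^ 3 := by
  have h0 : 0 ≤ ∫ x, |g x| ^ 3 := integral_nonneg fun x => by positivity
  have h1 : ∀ x, ‖g x‖ ^ (3 : ℝ) = |g x| ^ 3 := fun x => by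
    rw [Real.norm_eq_abs]; norm_cast
  rw [hg.eLpNorm_eq_integral_rpow_norm (by norm_num) (by norm_num)]
  simp only [ENNReal.toReal_ofNat, h1]
  rw [ENNReal.toReal_ofReal (by positivity), ← Real.rpow_natCast, ← Real.rpow_mul h0]
  norm_num

theorem tendsto_integral_abs_translate_sub_cube {f : E → ℝ} (hf : MemLp f 3 volume) :
    Tendsto (fun a : E => ∫ x, |f (x + a) - f x| ^ 3) (𝓝 0) (𝓝 0) := by
  have : Fact ((1 : ℝ≥0∞) ≤ 3) := ⟨by norm_num⟩
  have : Fact ((3 : ℝ≥0∞) ≠ ∞) := ⟨by norm_num⟩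
  have hsh : ∀ a : E, MemLp (fun x => f (x + a)) 3 volume := fun a =>
    hf.comp_measurePreserving (measurePreserving_add_right volume a)
  have hc : Continuous fun a : E => (DomAddAct.mk a) +ᵥ (hf.toLp f) :=
    (continuous_vadd (M := Eᵈᵃᵃ) (X := Lp ℝ 3 (volume : Measure E))).comp
      (DomAddAct.continuous_mk.prodMk continuous_const)
  have ht := tendsto_iff_edist_tendsto_0.1 (hc.tendsto 0)
  have he : ∀ a : E, edist (DomAddAct.mk a +ᵥ hf.toLp f) (DomAddAct.mk (0 : E) +ᵥ hf.toLp f) =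
      eLpNorm (fun x => f (x + a) - f x) 3 volume := fun a => by
    rw [DomAddAct.mk_vadd_toLp, DomAddAct.mk_vadd_toLp, Lp.edist_toLp_toLp]
    congr 1
    funext x
    simp [add_comm]
  simp only [he] at ht
  have h3 := ((ENNReal.tendsto_toReal ENNReal.zero_ne_top).comp ht).pow 3
  simp only [ENNReal.toReal_zero, ne_eq, OfNat.ofNat_ne_zero, not_false_eq_true, zero_pow] at h3
  refine h3.congr fun a => ?_
  exact (integral_abs_cube_eq ((hsh a).sub hf)).symm

theorem integrable_mul_translates {f : E → ℝ} (hm : Measurable f) (h0 : ∀ x, 0 ≤ f x)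
    (hf : Integrable (fun x => f x ^ 3) volume) (a b : E) :
    Integrable (fun x => f x * f (x + a) * f (x + b)) volume := by
  refine ((hf.add (hf.comp_add_right a)).add (hf.comp_add_right b)).mono'
    (by fun_prop) (Eventually.of_forall fun x => ?_)
  have := mul_mul_le_add_cubes (h0 x) (h0 (x + a)) (h0 (x + b)) one_pos
  rw [Real.norm_of_nonneg (mul_nonneg (mul_nonneg (h0 _) (h0 _)) (h0 _))]
  simpa using this

theorem tendsto_integral_mul_translates {f : E → ℝ} (hm : Measurable f) (h0 : ∀ x, 0 ≤ f x)
    (hf : Integrable (fun x => f x ^ 3) volume) {a b : ℕ → E} (ha : Tendsto a atTop (𝓝 0))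
    (hb : Tendsto b atTop (𝓝 0)) :
    Tendsto (fun n => ∫ x, f x * f (x + a n) * f (x + b n)) atTop (𝓝 (∫ x, f x ^ 3)) := by
  have hLp := memLp_three_of_integrable hm h0 hf
  set K := ∫ x, f x ^ 3 with hK
  have hK0 : 0 ≤ K := integral_nonneg fun x => pow_nonneg (h0 x) 3
  set L : E → ℝ := fun a => ∫ x, |f (x + a) - f x| ^ 3 with hL
  have hLt : Tendsto L (𝓝 0) (𝓝 0) := tendsto_integral_abs_translate_sub_cube hLp
  have hLint : ∀ a : E, Integrable (fun x => |f (x + a) - f x| ^ 3) volume := fun a => by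
    have h := (hLp.comp_measurePreserving (measurePreserving_add_right volume a)).sub hLp
    have := h.integrable_norm_rpow (by norm_num) (by norm_num)
    refine this.congr (Eventually.of_forall fun x => ?_)
    simp only [ENNReal.toReal_ofNat, Real.norm_eq_abs]
    norm_cast
  -- Replacing the two translates one at a time leaves two products, each with one small factor.
  -- First `δ` is fixed to control the term in `K`, then `u` and `v` tend to zero.
  have key : ∀ (δ : ℝ), 0 < δ → ∀ u v : E,
      |(∫ x, f x * f (x + u) * f (x + v)) - K| ≤ 4 * δ * K + δ⁻¹ ^ 2 * (L u + L v) := by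
    intro δ hδ u v
    rw [hK, ← integral_sub (integrable_mul_translates hm h0 hf u v) hf]
    have hT : ∫ x, f (x + u) ^ 3 = K := integral_add_right_eq_self (fun x => f x ^ 3) u
    have hbound : ∀ x, |f x * f (x + u) * f (x + v) - f x ^ 3| ≤
        δ * (3 * f x ^ 3 + f (x + u) ^ 3) +
          δ⁻¹ ^ 2 * (|f (x + u) - f x| ^ 3 + |f (x + v) - f x| ^ 3) := by
      intro x
      have h1 := mul_mul_le_add_cubes (h0 x) (h0 (x + u)) (abs_nonneg (f (x + v) - f x)) hδ
      have h2 := mul_mul_le_add_cubes (h0 x) (h0 x) (abs_nonneg (f (x + u) - f x)) hδ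
      have h3 : f x * f (x + u) * f (x + v) - f x ^ 3 =
          f x * f (x + u) * (f (x + v) - f x) + f x * f x * (f (x + u) - f x) := by ring
      rw [h3]
      refine (abs_add_le _ _).trans ?_
      rw [abs_mul, abs_mul (f x * f x), abs_of_nonneg (mul_nonneg (h0 x) (h0 (x + u))),
        abs_of_nonneg (mul_nonneg (h0 x) (h0 x))]
      linarith
    have hi1 : Integrable (fun x => δ * (3 * f x ^ 3 + f (x + u) ^ 3)) volume :=
      ((hf.const_mul 3).add (hf.comp_add_right u)).const_mul δ
    have hi2 : Integrable (fun x => δ⁻¹ ^ 2 * (|f (x + u) - f x| ^ 3 + |f (x + v) - f x| ^ 3))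
        volume := ((hLint u).add (hLint v)).const_mul _
    have hle := norm_integral_le_of_norm_le
      (f := fun x => f x * f (x + u) * f (x + v) - f x ^ 3) (hi1.add hi2) (Eventually.of_forall fun x => by
      rw [Real.norm_eq_abs]
      exact hbound x)
    rw [Real.norm_eq_abs] at hle
    refine hle.trans (le_of_eq ?_)
    simp only [Pi.add_apply]
    rw [integral_add hi1 hi2, integral_const_mul, integral_const_mul,
      integral_add (hf.const_mul 3) (hf.comp_add_right u), integral_const_mul,
      integral_add (hLint u) (hLint v), hT, ← hK]
    ring
  rw [Metric.tendsto_atTop']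
  intro ε hε
  set δ := ε / (8 * (K + 1)) with hδdef
  have hδ : 0 < δ := by positivity
  have hδK : 4 * δ * K < ε / 2 := by
    have : 4 * δ * (K + 1) = ε / 2 := by rw [hδdef]; field_simp; ring
    nlinarith
  have hlim : Tendsto (fun n => δ⁻¹ ^ 2 * (L (a n) + L (b n))) atTop (𝓝 0) := by
    have := ((hLt.comp ha).add (hLt.comp hb)).const_mul (δ⁻¹ ^ 2)
    simpa using this
  have hev := hlim.eventually (gt_mem_nhds (show (0 : ℝ) < ε / 2 by positivity))
  obtain ⟨N, hN⟩ := eventually_atTop.1 hev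
  refine ⟨N, fun n hn => ?_⟩
  rw [Real.dist_eq]
  have := key δ hδ (a n) (b n)
  have := hN n hn.le
  linarith

end Translates

/-! ### Asymptotic probability that a triple of points has a given local shape. -/

section LocalIntegrals

variable {E : Type*} [NormedAddCommGroup E] [InnerProductSpace ℝ E] [FiniteDimensional ℝ E]
  [MeasurableSpace E] [BorelSpace E]

theorem lintegral_eq_mul_lintegral_add_smul (h : E → ℝ≥0∞) (x : E) {r : ℝ} (hr : 0 < r) :
    ∫⁻ y, h y = ENNReal.ofReal (r ^ Module.finrank ℝ E) * ∫⁻ u, h (x + r • u) := by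
  have h1 : ∫⁻ y, h y = ∫⁻ y, h (x + y) :=
    (lintegral_add_left_eq_self h x).symm
  have h2 : ∫⁻ u, h (x + r • u) = ∫⁻ y, h (x + y) ∂(Measure.map (fun u : E => r • u) volume) :=
    (lintegral_map_equiv (fun y => h (x + y))
      (Homeomorph.smulOfNeZero r hr.ne').toMeasurableEquiv).symm
  rw [h2, Measure.map_addHaar_smul _ hr.ne', lintegral_smul_measure, h1, smul_eq_mul, ← mul_assoc,
    ← ENNReal.ofReal_mul (by positivity), abs_of_pos (by positivity),
    mul_inv_cancel₀ (by positivity), ENNReal.ofReal_one, one_mul]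

/-- Substitute `y = x + r u`, `z = x + r v`, each contributing one power of the Jacobian, and
integrate over `x` first by Tonelli. -/
theorem prod_prod_withDensity_scaled_apply {φ : E → ℝ≥0∞} (hφ : Measurable φ)
    (hφt : ∀ x, φ x < ∞) [SFinite (volume.withDensity φ : Measure E)]
    {S : Set (E × E)} (hS : MeasurableSet S) {r : ℝ} (hr : 0 < r) :
    ((volume.withDensity φ).prod ((volume.withDensity φ).prod (volume.withDensity φ)))
        {p : E × E × E | (r⁻¹ • (p.2.1 - p.1), r⁻¹ • (p.2.2 - p.1)) ∈ S} =
      ENNReal.ofReal (r ^ Module.finrank ℝ E) ^ 2 *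
        ∫⁻ q in S, ∫⁻ x, φ x * φ (x + r • q.1) * φ (x + r • q.2) := by
  set c := ENNReal.ofReal (r ^ Module.finrank ℝ E) with hc
  have hct : c ≠ ∞ := ENNReal.ofReal_ne_top
  have hT : MeasurableSet {p : E × E × E | (r⁻¹ • (p.2.1 - p.1), r⁻¹ • (p.2.2 - p.1)) ∈ S} :=
    hS.preimage (f := fun p : E × E × E => (r⁻¹ • (p.2.1 - p.1), r⁻¹ • (p.2.2 - p.1)))
      (by fun_prop)
  have hwd : ∀ g : E → ℝ≥0∞, ∫⁻ y, g y ∂(volume.withDensity φ) = ∫⁻ y, φ y * g y := fun g =>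
    lintegral_withDensity_eq_lintegral_mul_non_measurable volume hφ
      (Eventually.of_forall hφt) g
  rw [Measure.prod_apply hT]
  have hslice : ∀ x : E, ((volume.withDensity φ).prod (volume.withDensity φ)) (Prod.mk x ⁻¹'
      {p : E × E × E | (r⁻¹ • (p.2.1 - p.1), r⁻¹ • (p.2.2 - p.1)) ∈ S}) =
      c ^ 2 * ∫⁻ q, S.indicator 1 q * (φ (x + r • q.1) * φ (x + r • q.2)) := by
    intro x
    have hTx := hT.preimage (measurable_prodMk_left (x := x))
    rw [← lintegral_indicator_one hTx, lintegral_prod _ (by fun_prop (disch := assumption)), hwd]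
    simp only [hwd]
    rw [lintegral_eq_mul_lintegral_add_smul _ x hr, Measure.volume_eq_prod, lintegral_prod]
    · rw [sq, mul_assoc]
      congr 1
      rw [← lintegral_const_mul' c _ hct]
      refine lintegral_congr fun u => ?_
      rw [lintegral_eq_mul_lintegral_add_smul _ x hr, mul_left_comm, ← lintegral_const_mul'
        _ _ (hφt _).ne]
      congr 1
      refine lintegral_congr fun v => ?_
      have : (x + r • u, x + r • v) ∈ Prod.mk x ⁻¹'
          {p : E × E × E | (r⁻¹ • (p.2.1 - p.1), r⁻¹ • (p.2.2 - p.1)) ∈ S} ↔ (u, v) ∈ S := by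
        simp [smul_smul, inv_mul_cancel₀ hr.ne']
      by_cases h : (u, v) ∈ S
      · rw [Set.indicator_of_mem (this.2 h), Set.indicator_of_mem h]
        simp
      · rw [Set.indicator_of_notMem (fun hh => h (this.1 hh)), Set.indicator_of_notMem h]
        simp
    · have : Measurable (S.indicator (1 : E × E → ℝ≥0∞)) := measurable_one.indicator hS
      fun_prop
  simp only [hslice]
  rw [hwd]
  have h1S : Measurable (S.indicator (1 : E × E → ℝ≥0∞)) := measurable_one.indicator hS
  calc ∫⁻ x, φ x * (c ^ 2 * ∫⁻ q, S.indicator 1 q * (φ (x + r • q.1) * φ (x + r • q.2)))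
      = ∫⁻ x, c ^ 2 * ∫⁻ q, S.indicator 1 q * (φ x * φ (x + r • q.1) * φ (x + r • q.2)) := by
        refine lintegral_congr fun x => ?_
        rw [mul_left_comm, ← lintegral_const_mul' _ _ (hφt x).ne]
        congr 1
        refine lintegral_congr fun q => ?_
        ring
    _ = c ^ 2 * ∫⁻ q, ∫⁻ x, S.indicator 1 q * (φ x * φ (x + r • q.1) * φ (x + r • q.2)) := by
        rw [lintegral_const_mul' _ _ (ENNReal.pow_ne_top hct), lintegral_lintegral_swap]
        exact (by fun_prop : Measurable fun p : E × E × E =>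
          S.indicator 1 p.2 * (φ p.1 * φ (p.1 + r • p.2.1) * φ (p.1 + r • p.2.2))).aemeasurable
    _ = _ := by
        congr 1
        rw [← lintegral_indicator hS]
        refine lintegral_congr fun q => ?_
        by_cases h : q ∈ S
        · simp [Set.indicator_of_mem h]
        · simp [Set.indicator_of_notMem h]

/-- For each fixed shape `q` the integral over `x` converges by `tendsto_integral_mul_translates`
and is bounded by `3 ∫ f³`; dominated convergence over the finite-volume set `S` finishes. No
continuity of `f` is involved. -/
theorem tendsto_prod_prod_withDensity_scaled {f : E → ℝ} (hm : Measurable f) (h0 : ∀ x, 0 ≤ f x)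
    (hf : Integrable (fun x => f x ^ 3) volume)
    [SFinite (volume.withDensity fun x => ENNReal.ofReal (f x) : Measure E)]
    {S : Set (E × E)} (hS : MeasurableSet S) (hSt : volume S ≠ ∞) {r : ℕ → ℝ}
    (hr : ∀ᶠ n in atTop, 0 < r n) (hr0 : Tendsto r atTop (𝓝 0)) :
    Tendsto (fun n => ((volume.withDensity fun x => ENNReal.ofReal (f x)).prod
        ((volume.withDensity fun x => ENNReal.ofReal (f x)).prod
          (volume.withDensity fun x => ENNReal.ofReal (f x))))
        {p : E × E × E | ((r n)⁻¹ • (p.2.1 - p.1), (r n)⁻¹ • (p.2.2 - p.1)) ∈ S} /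
          ENNReal.ofReal (r n ^ Module.finrank ℝ E) ^ 2)
      atTop (𝓝 (volume S * ENNReal.ofReal (∫ x, f x ^ 3))) := by
  have hφ : Measurable fun x => ENNReal.ofReal (f x) := by fun_prop
  have hF : ∀ a b : E, ∫⁻ x, ENNReal.ofReal (f x) * ENNReal.ofReal (f (x + a)) *
      ENNReal.ofReal (f (x + b)) = ENNReal.ofReal (∫ x, f x * f (x + a) * f (x + b)) := by
    intro a b
    rw [ofReal_integral_eq_lintegral_ofReal (integrable_mul_translates hm h0 hf a b)
      (Eventually.of_forall fun x => mul_nonneg (mul_nonneg (h0 _) (h0 _)) (h0 _))]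
    refine lintegral_congr fun x => ?_
    rw [ENNReal.ofReal_mul (mul_nonneg (h0 _) (h0 _)), ENNReal.ofReal_mul (h0 _)]
  have hFle : ∀ a b : E, ∫ x, f x * f (x + a) * f (x + b) ≤ 3 * ∫ x, f x ^ 3 := by
    intro a b
    have hT : ∀ u : E, ∫ x, f (x + u) ^ 3 = ∫ x, f x ^ 3 := fun u =>
      integral_add_right_eq_self (fun x => f x ^ 3) u
    calc ∫ x, f x * f (x + a) * f (x + b)
        ≤ ∫ x, (f x ^ 3 + f (x + a) ^ 3 + f (x + b) ^ 3) := by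
          refine integral_mono (integrable_mul_translates hm h0 hf a b)
            ((hf.add (hf.comp_add_right a)).add (hf.comp_add_right b)) fun x => ?_
          simpa using mul_mul_le_add_cubes (h0 x) (h0 (x + a)) (h0 (x + b)) one_pos
      _ = 3 * ∫ x, f x ^ 3 := by
          have h2 : Integrable (fun x => f x ^ 3 + f (x + a) ^ 3) volume :=
            hf.add (hf.comp_add_right a)
          rw [integral_add h2 (hf.comp_add_right b), integral_add hf (hf.comp_add_right a), hT, hT]
          ring
  have hmain : Tendsto (fun n => ∫⁻ q in S, ∫⁻ x, ENNReal.ofReal (f x) *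
      ENNReal.ofReal (f (x + r n • q.1)) * ENNReal.ofReal (f (x + r n • q.2))) atTop
      (𝓝 (∫⁻ _ in S, ENNReal.ofReal (∫ x, f x ^ 3))) := by
    refine tendsto_lintegral_of_dominated_convergence
      (fun _ => ENNReal.ofReal (3 * ∫ x, f x ^ 3)) (fun n => ?_) (fun n => ?_) ?_ ?_
    · exact Measurable.lintegral_prod_right' (f := fun p : (E × E) × E => ENNReal.ofReal (f p.2) *
        ENNReal.ofReal (f (p.2 + r n • p.1.1)) * ENNReal.ofReal (f (p.2 + r n • p.1.2)))
        (by fun_prop)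
    · refine Eventually.of_forall fun q => ?_
      simp only [hF]
      exact ENNReal.ofReal_le_ofReal (hFle _ _)
    · rw [setLIntegral_const]
      exact ENNReal.mul_ne_top ENNReal.ofReal_ne_top hSt
    · refine Eventually.of_forall fun q => ?_
      simp only [hF]
      refine ENNReal.tendsto_ofReal (tendsto_integral_mul_translates hm h0 hf ?_ ?_)
      · simpa using hr0.smul_const q.1
      · simpa using hr0.smul_const q.2
  rw [setLIntegral_const, mul_comm] at hmain
  refine hmain.congr' ?_
  filter_upwards [hr] with n hr
  have hc0 : ENNReal.ofReal (r n ^ Module.finrank ℝ E) ^ 2 ≠ 0 :=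
    pow_ne_zero _ (ENNReal.ofReal_pos.2 (pow_pos hr _)).ne'
  rw [prod_prod_withDensity_scaled_apply hφ (fun x => ENNReal.ofReal_lt_top) hS hr,
    mul_comm, ENNReal.mul_div_cancel_right hc0 (ENNReal.pow_ne_top ENNReal.ofReal_ne_top)]

end LocalIntegrals

/-! ### Probability of a star of short edges. -/

section Stars

variable {E : Type*} [NormedAddCommGroup E] [InnerProductSpace ℝ E] [FiniteDimensional ℝ E]
  [MeasurableSpace E] [BorelSpace E]

theorem lintegral_pow_succ_le_measure_univ_pow_mul {α : Type*} [MeasurableSpace α] (ν : Measure α) {φ : α → ℝ≥0∞}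
    (hφ : Measurable φ) (m : ℕ) :
    (∫⁻ y, φ y ∂ν) ^ (m + 1) ≤ ν Set.univ ^ m * ∫⁻ y, φ y ^ (m + 1) ∂ν := by
  have h := eLpNorm_le_eLpNorm_mul_rpow_measure_univ (p := 1) (q := ((m + 1 : ℕ) : ℝ≥0∞))
    (μ := ν) (f := φ) (by exact_mod_cast Nat.le_add_left 1 m) hφ.aestronglyMeasurable
  rw [eLpNorm_one_eq_lintegral_enorm, eLpNorm_eq_lintegral_rpow_enorm_toReal (by positivity)
    (ENNReal.natCast_ne_top _)] at h
  simp only [enorm_eq_self, ENNReal.toReal_natCast, ENNReal.toReal_one, ENNReal.rpow_natCast] at h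
  have hm0 : ((m + 1 : ℕ) : ℝ) ≠ 0 := by positivity
  calc (∫⁻ y, φ y ∂ν) ^ (m + 1) ≤ _ := pow_le_pow_left' h (m + 1)
    _ = ν Set.univ ^ m * ∫⁻ y, φ y ^ (m + 1) ∂ν := by
      rw [mul_pow, mul_comm]
      congr 1
      · rw [← ENNReal.rpow_natCast, ← ENNReal.rpow_mul, ← ENNReal.rpow_natCast]
        congr 1
        field_simp
        push_cast
        ring
      · rw [← ENNReal.rpow_natCast, ← ENNReal.rpow_mul, one_div, inv_mul_cancel₀ hm0,
          ENNReal.rpow_one]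

/-- Compare `P` with `b * a`. In the application `a` is the density at a point, `b` the volume of a
ball about it and `P` its mass, so that both terms have order `b ^ m` after integration. -/
theorem mul_pow_le_add_of_ne {a P b : ℝ≥0∞} (hb0 : b ≠ 0) (hbt : b ≠ ∞) (m : ℕ) :
    a * P ^ m ≤ b ^ m * a ^ (m + 1) + b⁻¹ * P ^ (m + 1) := by
  rcases le_total P (b * a) with h | h
  · calc a * P ^ m ≤ a * (b * a) ^ m := by gcongr
      _ = b ^ m * a ^ (m + 1) := by ring
      _ ≤ _ := le_self_add
  · have h1 : a ≤ b⁻¹ * P := by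
      rw [mul_comm, ← div_eq_mul_inv, ENNReal.le_div_iff_mul_le (Or.inl hb0) (Or.inl hbt), mul_comm]
      exact h
    calc a * P ^ m ≤ b⁻¹ * P * P ^ m := by gcongr
      _ = b⁻¹ * P ^ (m + 1) := by ring
      _ ≤ _ := le_add_self

theorem setLIntegral_closedBall_eq (h : E → ℝ≥0∞) (x : E) (R : ℝ) :
    ∫⁻ y in Metric.closedBall x R, h y = ∫⁻ u in Metric.closedBall 0 R, h (x + u) := by
  rw [← lintegral_indicator measurableSet_closedBall, ← lintegral_indicator measurableSet_closedBall,
    ← lintegral_add_left_eq_self _ x]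
  refine lintegral_congr fun u => ?_
  simp [Set.indicator, dist_eq_norm]

/-- The mass of a ball is an integral of translates of `φ`; the power mean inequality moves the
exponent inside, and translation invariance evaluates the result. This is the source of the moment
of order `m + 1` for a star with `m` edges. -/
theorem lintegral_withDensity_closedBall_pow_le {φ : E → ℝ≥0∞} (hφ : Measurable φ)
    (hφt : ∀ x, φ x < ∞) {R : ℝ} (hR : 0 < R) (m : ℕ) :
    ∫⁻ x, (volume.withDensity φ) (Metric.closedBall x R) ^ m ∂(volume.withDensity φ) ≤
      2 * volume (Metric.closedBall (0 : E) R) ^ m * ∫⁻ x, φ x ^ (m + 1) := by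
  set b := volume (Metric.closedBall (0 : E) R) with hb
  set M := ∫⁻ x, φ x ^ (m + 1) with hM
  have hb0 : b ≠ 0 := (Metric.measure_closedBall_pos volume 0 hR).ne'
  have hbt : b ≠ ∞ := measure_closedBall_lt_top.ne
  have hP : ∀ x, (volume.withDensity φ) (Metric.closedBall x R) =
      ∫⁻ u in Metric.closedBall 0 R, φ (x + u) := fun x => by
    rw [withDensity_apply _ measurableSet_closedBall, setLIntegral_closedBall_eq]
  have hPk : ∀ x, (volume.withDensity φ) (Metric.closedBall x R) ^ (m + 1) ≤
      b ^ m * ∫⁻ u in Metric.closedBall 0 R, φ (x + u) ^ (m + 1) := fun x => by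
    rw [hP]
    have := lintegral_pow_succ_le_measure_univ_pow_mul (volume.restrict (Metric.closedBall (0 : E) R))
      (φ := fun u => φ (x + u)) (by fun_prop) m
    rwa [Measure.restrict_apply_univ] at this
  have hswap : ∫⁻ x, ∫⁻ u in Metric.closedBall (0 : E) R, φ (x + u) ^ (m + 1) = b * M := by
    rw [lintegral_lintegral_swap (by
      exact (by fun_prop : Measurable fun p : E × E => φ (p.1 + p.2) ^ (m + 1)).aemeasurable)]
    have : ∀ u : E, ∫⁻ x, φ (x + u) ^ (m + 1) = M := fun u =>
      lintegral_add_right_eq_self (fun x => φ x ^ (m + 1)) u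
    simp only [this]
    rw [setLIntegral_const, mul_comm]
  rw [lintegral_withDensity_eq_lintegral_mul_non_measurable volume hφ
      (Eventually.of_forall hφt)]
  calc ∫⁻ x, (φ * fun x => (volume.withDensity φ) (Metric.closedBall x R) ^ m) x
      ≤ ∫⁻ x, (b ^ m * φ x ^ (m + 1) +
          b⁻¹ * (b ^ m * ∫⁻ u in Metric.closedBall 0 R, φ (x + u) ^ (m + 1))) :=
        lintegral_mono fun x => (mul_pow_le_add_of_ne hb0 hbt m).trans (by gcongr; exact hPk x)
    _ = b ^ m * M + b⁻¹ * (b ^ m * (b * M)) := by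
        rw [lintegral_add_left (by fun_prop), lintegral_const_mul' _ _ (ENNReal.pow_ne_top hbt),
          lintegral_const_mul' _ _ (ENNReal.inv_ne_top.2 hb0),
          lintegral_const_mul' _ _ (ENNReal.pow_ne_top hbt), hswap]
    _ = 2 * b ^ m * M := by
        rw [show b⁻¹ * (b ^ m * (b * M)) = b⁻¹ * b * (b ^ m * M) by ring,
          ENNReal.inv_mul_cancel hb0 hbt]
        ring

/-- Given the position `y` of the centre `v`, the event is a product of conditions on the other,
independent points. -/
theorem pi_star_eq_lintegral {n : ℕ} (μ : Measure E) [IsProbabilityMeasure μ] (R : ℝ) {v : Fin n}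
    {T : Finset (Fin n)} (hv : v ∉ T) :
    Measure.pi (fun _ : Fin n => μ) {x | ∀ j ∈ T, dist (x j) (x v) ≤ R} =
      ∫⁻ y, μ (Metric.closedBall y R) ^ T.card ∂μ := by
  obtain _ | n := n
  · exact v.elim0
  have hm : MeasurableSet {x : Fin (n + 1) → E | ∀ j ∈ T, dist (x j) (x v) ≤ R} := by
    have : {x : Fin (n + 1) → E | ∀ j ∈ T, dist (x j) (x v) ≤ R} =
        ⋂ j ∈ T, {x | dist (x j) (x v) ≤ R} := by ext; simp
    rw [this]
    exact Finset.measurableSet_biInter T fun j _ =>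
      measurableSet_le (f := fun x : Fin (n + 1) → E => dist (x j) (x v)) (by fun_prop)
        measurable_const
  have hmp := (measurePreserving_piFinSuccAbove (fun _ : Fin (n + 1) => μ) v).symm
  rw [← hmp.measure_preimage hm.nullMeasurableSet, Measure.prod_apply (hm.preimage hmp.measurable)]
  refine lintegral_congr fun y => ?_
  have hset : Prod.mk y ⁻¹' ((MeasurableEquiv.piFinSuccAbove (fun _ : Fin (n + 1) => E) v).symm ⁻¹'
      {x | ∀ j ∈ T, dist (x j) (x v) ≤ R}) =
      Set.univ.pi fun j => if v.succAbove j ∈ T then Metric.closedBall y R else Set.univ := by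
    ext x
    have hins : (MeasurableEquiv.piFinSuccAbove (fun _ : Fin (n + 1) => E) v).symm (y, x) =
        v.insertNth y x := rfl
    simp only [Set.mem_preimage, Set.mem_ofPred_eq, Set.mem_pi, Set.mem_univ, true_imp_iff,
      hins, Fin.insertNth_apply_same]
    rw [Fin.forall_iff_succAbove v]
    simp only [hv, false_imp_iff, true_and, Fin.insertNth_apply_succAbove]
    refine forall_congr' fun j => ?_
    by_cases h : v.succAbove j ∈ T <;> simp [h]
  rw [hset, Measure.pi_pi]
  have h1 : ∀ j, μ (if v.succAbove j ∈ T then Metric.closedBall y R else Set.univ) =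
      if v.succAbove j ∈ T then μ (Metric.closedBall y R) else 1 := fun j => by
    split_ifs <;> simp
  simp only [h1]
  have h2 := Fin.prod_univ_succAbove
    (fun j => if j ∈ T then μ (Metric.closedBall y R) else 1) v
  rw [if_neg hv, one_mul] at h2
  rw [← h2, Finset.prod_ite_mem, Finset.univ_inter, Finset.prod_const]

end Stars

/-! ### Counting triples and pairs of overlapping triples. -/

section Triples

/-- The triples `(i, j, k)` with `i < j < k`. -/
def orderedTriples (n : ℕ) : Finset (Fin n × Fin n × Fin n) :=
  Finset.univ.filter fun t => t.1 < t.2.1 ∧ t.2.1 < t.2.2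

/-- The set of entries of a triple. -/
def tripleSupport {n : ℕ} (t : Fin n × Fin n × Fin n) : Finset (Fin n) := {t.1, t.2.1, t.2.2}

theorem mem_orderedTriples {n : ℕ} {t : Fin n × Fin n × Fin n} :
    t ∈ orderedTriples n ↔ t.1 < t.2.1 ∧ t.2.1 < t.2.2 := by
  simp [orderedTriples]

theorem sum_Ioi_eq_sum_orderedTriples {n : ℕ} (F : Fin n → Fin n → Fin n → ℝ) :
    ∑ i : Fin n, ∑ j ∈ Finset.Ioi i, ∑ k ∈ Finset.Ioi j, F i j k =
      ∑ t ∈ orderedTriples n, F t.1 t.2.1 t.2.2 := by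
  rw [orderedTriples, Finset.sum_filter, Fintype.sum_prod_type]
  refine Finset.sum_congr rfl fun i _ => ?_
  rw [Fintype.sum_prod_type]
  have h1 : Finset.Ioi i = Finset.univ.filter fun j => i < j := by ext; simp
  rw [h1, Finset.sum_filter]
  refine Finset.sum_congr rfl fun j _ => ?_
  have h2 : Finset.Ioi j = Finset.univ.filter fun k => j < k := by ext; simp
  rw [h2, Finset.sum_filter]
  by_cases hij : i < j <;> simp [hij]

theorem card_tripleSupport {n : ℕ} {t : Fin n × Fin n × Fin n} (ht : t ∈ orderedTriples n) :
    (tripleSupport t).card = 3 := by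
  rw [mem_orderedTriples] at ht
  exact Finset.card_eq_three.2 ⟨_, _, _, ht.1.ne, (ht.1.trans ht.2).ne, ht.2.ne, rfl⟩

/-- A pair is encoded by an enumeration of its union, one of `n ^ m` maps, and the positions of its
six entries there. -/
theorem card_pairs_union_eq_le (n m : ℕ) :
    ((orderedTriples n ×ˢ orderedTriples n).filter fun p =>
      (tripleSupport p.1 ∪ tripleSupport p.2).card = m).card ≤ m ^ 6 * n ^ m := by
  let Φ : (Fin m → Fin n) × (Fin m × Fin m × Fin m) × (Fin m × Fin m × Fin m) →
      (Fin n × Fin n × Fin n) × (Fin n × Fin n × Fin n) := fun q =>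
    ((q.1 q.2.1.1, q.1 q.2.1.2.1, q.1 q.2.1.2.2), (q.1 q.2.2.1, q.1 q.2.2.2.1, q.1 q.2.2.2.2))
  have hsub : ((orderedTriples n ×ˢ orderedTriples n).filter fun p =>
      (tripleSupport p.1 ∪ tripleSupport p.2).card = m) ⊆ Finset.univ.image Φ := by
    rintro ⟨⟨i, j, k⟩, ⟨i', j', k'⟩⟩ hp
    have hcard := (Finset.mem_filter.1 hp).2
    set U := tripleSupport (i, j, k) ∪ tripleSupport (i', j', k') with hU
    let e := (U.orderIsoOfFin hcard)
    have hex : ∀ u ∈ U, ∃ a : Fin m, (e a : Fin n) = u := fun u hu =>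
      ⟨e.symm ⟨u, hu⟩, by simp⟩
    obtain ⟨a, ha⟩ := hex i (by simp [hU, tripleSupport])
    obtain ⟨b, hb⟩ := hex j (by simp [hU, tripleSupport])
    obtain ⟨c, hc⟩ := hex k (by simp [hU, tripleSupport])
    obtain ⟨a', ha'⟩ := hex i' (by simp [hU, tripleSupport])
    obtain ⟨b', hb'⟩ := hex j' (by simp [hU, tripleSupport])
    obtain ⟨c', hc'⟩ := hex k' (by simp [hU, tripleSupport])
    refine Finset.mem_image.2 ⟨(fun a => (e a : Fin n), (a, b, c), (a', b', c')),
      Finset.mem_univ _, ?_⟩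
    simp only [Φ, ha, hb, hc, ha', hb', hc']
  refine (Finset.card_le_card hsub).trans (Finset.card_image_le.trans (le_of_eq ?_))
  simp only [Finset.card_univ, Fintype.card_prod, Fintype.card_fun, Fintype.card_fin]
  ring

theorem pow_three_div_le_card_orderedTriples {n : ℕ} (hn : 3 ≤ n) :
    (n : ℝ) ^ 3 / 729 ≤ (orderedTriples n).card := by
  -- Taking one index from each of three consecutive blocks of length `m` gives `m ^ 3` triples; `m
  -- ≥ n / 9` for `n ≥ 3`, and `729 = 9 ^ 3`.
  set m := n / 3 with hm
  let Φ : Fin m × Fin m × Fin m → Fin n × Fin n × Fin n := fun q =>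
    (⟨q.1, by omega⟩, ⟨m + q.2.1, by omega⟩, ⟨2 * m + q.2.2, by omega⟩)
  have hinj : Function.Injective Φ := by
    rintro ⟨a, b, c⟩ ⟨a', b', c'⟩ h
    simp only [Φ, Prod.mk.injEq, Fin.mk.injEq, add_right_inj] at h
    exact Prod.ext (Fin.ext h.1) (Prod.ext (Fin.ext h.2.1) (Fin.ext h.2.2))
  have hsub : Finset.univ.image Φ ⊆ orderedTriples n := by
    intro t ht
    obtain ⟨q, -, rfl⟩ := Finset.mem_image.1 ht
    rw [mem_orderedTriples]
    simp only [Φ, Fin.mk_lt_mk]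
    omega
  have hcard := Finset.card_le_card hsub
  rw [Finset.card_image_of_injective _ hinj, Finset.card_univ] at hcard
  simp only [Fintype.card_prod, Fintype.card_fin] at hcard
  have h1 : (n : ℝ) / 9 ≤ m := by
    rw [div_le_iff₀ (by norm_num)]
    have : n ≤ m * 9 := by omega
    exact_mod_cast this
  calc (n : ℝ) ^ 3 / 729 = (n / 9) ^ 3 := by ring
    _ ≤ (m : ℝ) ^ 3 := by gcongr
    _ ≤ _ := by
      have : m ^ 3 ≤ (orderedTriples n).card := by
        calc m ^ 3 = m * (m * m) := by ring
          _ ≤ _ := hcard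
      exact_mod_cast this

end Triples

/-! ### Mean and variance of a triple count. -/

section TripleSums

variable {E : Type*} [MeasurableSpace E]

/-- The points of a configuration at a triple of indices, the last index first. -/
def tripleEval {n : ℕ} (t : Fin n × Fin n × Fin n) (x : Fin n → E) : E × E × E :=
  (x t.2.2, x t.1, x t.2.1)

/-- The number of ordered triples at which a configuration falls into `B`. -/
noncomputable def tripleSum {n : ℕ} (B : Set (E × E × E)) (x : Fin n → E) : ℝ :=
  ∑ t ∈ orderedTriples n, (tripleEval t ⁻¹' B).indicator 1 x

theorem measurable_tripleEval {n : ℕ} (t : Fin n × Fin n × Fin n) :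
    Measurable (tripleEval t : (Fin n → E) → E × E × E) := by
  unfold tripleEval
  fun_prop

theorem map_tripleEval {n : ℕ} (μ : Measure E) [IsProbabilityMeasure μ]
    {t : Fin n × Fin n × Fin n} (ht : t ∈ orderedTriples n) :
    (Measure.pi fun _ : Fin n => μ).map (tripleEval t) = μ.prod (μ.prod μ) := by
  rw [mem_orderedTriples] at ht
  have hind : iIndepFun (fun (i : Fin n) (x : Fin n → E) => x i) (Measure.pi fun _ : Fin n => μ) :=
    iIndepFun_pi (μ := fun _ : Fin n => μ) (X := fun _ => id) fun _ => aemeasurable_id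
  have hev : ∀ i : Fin n, (Measure.pi fun _ : Fin n => μ).map (fun x => x i) = μ := fun i =>
    (measurePreserving_eval (fun _ : Fin n => μ) i).map_eq
  have h1 := (hind.indepFun_prodMk (fun i => measurable_pi_apply i) t.1 t.2.1 t.2.2
    (ht.1.trans ht.2).ne ht.2.ne).symm
  have h2 := hind.indepFun ht.1.ne
  have hpi : ∀ i : Fin n, AEMeasurable (fun x : Fin n → E => x i)
      (Measure.pi fun _ : Fin n => μ) := fun i => (measurable_pi_apply i).aemeasurable
  rw [indepFun_iff_map_prod_eq_prod_map_map (hpi _) ((hpi _).prodMk (hpi _))] at h1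
  rw [indepFun_iff_map_prod_eq_prod_map_map (hpi _) (hpi _)] at h2
  rw [h2, hev, hev, hev] at h1
  exact h1

theorem measureReal_tripleEval {n : ℕ} (μ : Measure E) [IsProbabilityMeasure μ]
    {t : Fin n × Fin n × Fin n} (ht : t ∈ orderedTriples n) {B : Set (E × E × E)}
    (hB : MeasurableSet B) :
    (Measure.pi fun _ : Fin n => μ).real (tripleEval t ⁻¹' B) = (μ.prod (μ.prod μ)).real B := by
  rw [← map_tripleEval μ ht, map_measureReal_apply (measurable_tripleEval t) hB]

theorem memLp_indicator_tripleEval {n : ℕ} (μ : Measure E) [IsProbabilityMeasure μ]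
    (t : Fin n × Fin n × Fin n) {B : Set (E × E × E)} (hB : MeasurableSet B) :
    MemLp ((tripleEval t ⁻¹' B).indicator (1 : (Fin n → E) → ℝ)) 2
      (Measure.pi fun _ : Fin n => μ) :=
  memLp_indicator_const 2 (hB.preimage (measurable_tripleEval t)) 1 (Or.inr (measure_ne_top _ _))

theorem memLp_tripleSum {n : ℕ} (μ : Measure E) [IsProbabilityMeasure μ] {B : Set (E × E × E)}
    (hB : MeasurableSet B) :
    MemLp (tripleSum B : (Fin n → E) → ℝ) 2 (Measure.pi fun _ : Fin n => μ) := by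
  unfold tripleSum
  exact memLp_finsetSum _ fun t _ => memLp_indicator_tripleEval μ t hB

theorem integral_tripleSum {n : ℕ} (μ : Measure E) [IsProbabilityMeasure μ] {B : Set (E × E × E)}
    (hB : MeasurableSet B) :
    ∫ x, tripleSum B x ∂(Measure.pi fun _ : Fin n => μ) =
      (orderedTriples n).card * (μ.prod (μ.prod μ)).real B := by
  unfold tripleSum
  rw [integral_finsetSum _ fun t _ => (memLp_indicator_tripleEval μ t hB).integrable (by norm_num),
    Finset.sum_congr rfl fun t ht => ?_, Finset.sum_const, nsmul_eq_mul]
  rw [integral_indicator_one (hB.preimage (measurable_tripleEval t)), measureReal_tripleEval μ ht hB]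

theorem covariance_indicator_tripleEval_of_disjoint {n : ℕ} (μ : Measure E)
    [IsProbabilityMeasure μ] {s t : Fin n × Fin n × Fin n}
    (hst : Disjoint (tripleSupport s) (tripleSupport t)) {B : Set (E × E × E)}
    (hB : MeasurableSet B) :
    covariance ((tripleEval s ⁻¹' B).indicator (1 : (Fin n → E) → ℝ))
      ((tripleEval t ⁻¹' B).indicator 1) (Measure.pi fun _ : Fin n => μ) = 0 := by
  have hind : iIndepFun (fun (i : Fin n) (x : Fin n → E) => x i) (Measure.pi fun _ : Fin n => μ) :=
    iIndepFun_pi (μ := fun _ : Fin n => μ) (X := fun _ => id) fun _ => aemeasurable_id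
  have h := hind.indepFun_finset _ _ hst fun i => measurable_pi_apply i
  refine IndepFun.covariance_eq_zero ?_ (memLp_indicator_tripleEval μ s hB)
    (memLp_indicator_tripleEval μ t hB)
  let F : (u : Fin n × Fin n × Fin n) → (tripleSupport u → E) → ℝ := fun u y =>
    B.indicator 1 (y ⟨u.2.2, by simp [tripleSupport]⟩, y ⟨u.1, by simp [tripleSupport]⟩,
      y ⟨u.2.1, by simp [tripleSupport]⟩)
  have hF : ∀ u, Measurable (F u) := fun u =>
    (measurable_one.indicator hB).comp (by fun_prop)
  exact h.comp (hF s) (hF t)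

theorem covariance_indicator_tripleEval_le {n : ℕ} (μ : Measure E)
    [IsProbabilityMeasure μ] (s t : Fin n × Fin n × Fin n) {B : Set (E × E × E)}
    (hB : MeasurableSet B) :
    covariance ((tripleEval s ⁻¹' B).indicator (1 : (Fin n → E) → ℝ))
      ((tripleEval t ⁻¹' B).indicator 1) (Measure.pi fun _ : Fin n => μ) ≤
      (Measure.pi fun _ : Fin n => μ).real (tripleEval s ⁻¹' B ∩ tripleEval t ⁻¹' B) := by
  have hs := hB.preimage (measurable_tripleEval (E := E) s)
  have ht := hB.preimage (measurable_tripleEval (E := E) t)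
  rw [covariance_eq_sub (memLp_indicator_tripleEval μ s hB) (memLp_indicator_tripleEval μ t hB),
    integral_indicator_one hs, integral_indicator_one ht, ← Set.inter_indicator_one,
    integral_indicator_one (hs.inter ht)]
  exact sub_le_self _ (by positivity)

/-- Only pairs of triples that meet contribute, and their unions have size 3, 4 or 5. Each
covariance is bounded by the joint probability. -/
theorem variance_tripleSum_le {n : ℕ} (μ : Measure E) [IsProbabilityMeasure μ]
    {B : Set (E × E × E)} (hB : MeasurableSet B) {ρ C : ℝ} (hρ : 0 ≤ ρ) (hC : 0 ≤ C)
    (hpair : ∀ s ∈ orderedTriples n, ∀ t ∈ orderedTriples n,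
      ¬Disjoint (tripleSupport s) (tripleSupport t) →
      (Measure.pi fun _ : Fin n => μ).real (tripleEval s ⁻¹' B ∩ tripleEval t ⁻¹' B) ≤
        C * ρ ^ ((tripleSupport s ∪ tripleSupport t).card - 1)) :
    variance (tripleSum B) (Measure.pi fun _ : Fin n => μ) ≤
      15625 * C * ((n : ℝ) ^ 3 * ρ ^ 2 + n ^ 4 * ρ ^ 3 + n ^ 5 * ρ ^ 4) := by
  set Q := Measure.pi fun _ : Fin n => μ
  set T := orderedTriples n
  let c : (Fin n × Fin n × Fin n) × (Fin n × Fin n × Fin n) → ℕ := fun p =>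
    (tripleSupport p.1 ∪ tripleSupport p.2).card
  have hvar : variance (tripleSum B) Q = ∑ p ∈ T ×ˢ T,
      covariance ((tripleEval p.1 ⁻¹' B).indicator (1 : (Fin n → E) → ℝ))
        ((tripleEval p.2 ⁻¹' B).indicator 1) Q := by
    rw [Finset.sum_product]
    exact variance_fun_sum' fun t _ => memLp_indicator_tripleEval μ t hB
  have hterm : ∀ p ∈ T ×ˢ T,
      covariance ((tripleEval p.1 ⁻¹' B).indicator (1 : (Fin n → E) → ℝ))
        ((tripleEval p.2 ⁻¹' B).indicator 1) Q ≤
      ∑ m ∈ ({3, 4, 5} : Finset ℕ), if c p = m then C * ρ ^ (m - 1) else 0 := by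
    rintro ⟨s, t⟩ hp
    obtain ⟨hs, ht⟩ : s ∈ T ∧ t ∈ T := Finset.mem_product.1 hp
    by_cases hd : Disjoint (tripleSupport s) (tripleSupport t)
    · rw [covariance_indicator_tripleEval_of_disjoint μ hd hB]
      exact Finset.sum_nonneg fun m _ => by split_ifs <;> positivity
    · refine (covariance_indicator_tripleEval_le μ s t hB).trans ((hpair s hs t ht hd).trans ?_)
      have h3 := card_tripleSupport hs
      have h3' := card_tripleSupport ht
      have hlow : 3 ≤ c (s, t) := by
        rw [← h3]; exact Finset.card_le_card Finset.subset_union_left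
      have hup : c (s, t) ≤ 5 := by
        have h1 := Finset.card_union_add_card_inter (tripleSupport s) (tripleSupport t)
        have h2 : 0 < (tripleSupport s ∩ tripleSupport t).card :=
          Finset.card_pos.2 (Finset.not_disjoint_iff_nonempty_inter.1 hd)
        change (tripleSupport s ∪ tripleSupport t).card ≤ 5
        omega
      rw [Finset.sum_ite_eq, if_pos]
      simp only [Finset.mem_insert, Finset.mem_singleton]
      omega
  have hcount : ∀ m : ℕ, m ≤ 5 → ∑ p ∈ T ×ˢ T, (if c p = m then C * ρ ^ (m - 1) else 0) ≤
      15625 * C * ((n : ℝ) ^ m * ρ ^ (m - 1)) := by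
    intro m hm
    rw [← Finset.sum_filter, Finset.sum_const, nsmul_eq_mul]
    have h1 : (((T ×ˢ T).filter fun p => c p = m).card : ℝ) ≤ 15625 * (n : ℝ) ^ m := by
      -- The constant `15625` is `5 ^ 6`, which bounds `m ^ 6` for all three sizes.
      have h2 : ((T ×ˢ T).filter fun p => c p = m).card ≤ 5 ^ 6 * n ^ m :=
        (card_pairs_union_eq_le n m).trans (by gcongr)
      exact_mod_cast h2
    calc _ ≤ 15625 * (n : ℝ) ^ m * (C * ρ ^ (m - 1)) := by gcongr
      _ = _ := by ring
  rw [hvar]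
  refine (Finset.sum_le_sum hterm).trans ?_
  rw [Finset.sum_comm, Finset.sum_insert (by decide), Finset.sum_insert (by decide),
    Finset.sum_singleton]
  have h3 := hcount 3 (by norm_num)
  have h4 := hcount 4 (by norm_num)
  have h5 := hcount 5 (by norm_num)
  norm_num at h3 h4 h5 ⊢
  linarith

end TripleSums

/-! ### Overlapping triples lie in stars. -/

section StarBounds

/-- The shared vertex `v` need not be the centre of either triple, but two points of a triple are
both within `r` of its centre; hence the radius `2 * r`. -/
theorem tripleEval_inter_subset_star {E : Type*} [PseudoMetricSpace E]
    {n : ℕ} {B : Set (E × E × E)} {r : ℝ}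
    (hr : 0 ≤ r) (hBr : ∀ p ∈ B, dist p.1 p.2.1 ≤ r ∧ dist p.1 p.2.2 ≤ r)
    {s t : Fin n × Fin n × Fin n} {v : Fin n} (hs : v ∈ tripleSupport s)
    (ht : v ∈ tripleSupport t) :
    tripleEval s ⁻¹' B ∩ tripleEval t ⁻¹' B ⊆
      {x | ∀ j ∈ (tripleSupport s ∪ tripleSupport t).erase v, dist (x j) (x v) ≤ 2 * r} := by
  have key : ∀ (u : Fin n × Fin n × Fin n) (x : Fin n → E), x ∈ tripleEval u ⁻¹' B →
      ∀ a ∈ tripleSupport u, ∀ b ∈ tripleSupport u, dist (x a) (x b) ≤ 2 * r := by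
    intro u x hx a ha b hb
    obtain ⟨h1, h2⟩ := hBr _ hx
    simp only [tripleEval] at h1 h2
    have hc : ∀ a ∈ tripleSupport u, dist (x a) (x u.2.2) ≤ r := by
      intro a ha
      simp only [tripleSupport, Finset.mem_insert, Finset.mem_singleton] at ha
      rcases ha with rfl | rfl | rfl
      · rwa [dist_comm]
      · rwa [dist_comm]
      · rwa [dist_self]
    have := dist_triangle_right (x a) (x b) (x u.2.2)
    have := hc a ha
    have := hc b hb
    linarith
  rintro x ⟨hxs, hxt⟩ j hj
  rcases Finset.mem_union.1 (Finset.mem_of_mem_erase hj) with h | h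
  · exact key s x hxs j h v hs
  · exact key t x hxt j h v ht

variable {E : Type*} [NormedAddCommGroup E] [InnerProductSpace ℝ E] [FiniteDimensional ℝ E]
  [MeasurableSpace E] [BorelSpace E]

theorem pi_real_tripleEval_inter_le {f : E → ℝ} (hm : Measurable f) (h0 : ∀ x, 0 ≤ f x)
    [IsProbabilityMeasure (volume.withDensity fun x => ENNReal.ofReal (f x) : Measure E)]
    {k : ℕ} (hf : Integrable (fun x => f x ^ k) volume) {n : ℕ}
    {B : Set (E × E × E)} {r : ℝ} (hr : 0 < r)
    (hBr : ∀ p ∈ B, dist p.1 p.2.1 ≤ r ∧ dist p.1 p.2.2 ≤ r)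
    {s t : Fin n × Fin n × Fin n} (hst : ¬Disjoint (tripleSupport s) (tripleSupport t))
    (hk : (tripleSupport s ∪ tripleSupport t).card = k) :
    (Measure.pi fun _ : Fin n => volume.withDensity fun x => ENNReal.ofReal (f x)).real
        (tripleEval s ⁻¹' B ∩ tripleEval t ⁻¹' B) ≤
      2 * (2 ^ Module.finrank ℝ E * (volume (Metric.closedBall (0 : E) 1)).toReal) ^ (k - 1) *
        (∫ x, f x ^ k) * (r ^ Module.finrank ℝ E) ^ (k - 1) := by
  obtain ⟨v, hs, ht⟩ := Finset.not_disjoint_iff.1 hst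
  have hcard : ((tripleSupport s ∪ tripleSupport t).erase v).card = k - 1 := by
    rw [Finset.card_erase_of_mem (Finset.mem_union_left _ hs), hk]
  have hk1 : k - 1 + 1 = k := by
    have : 0 < k := hk ▸ Finset.card_pos.2 ⟨v, Finset.mem_union_left _ hs⟩
    omega
  have hle := (measure_mono (tripleEval_inter_subset_star hr.le hBr hs ht)).trans
    ((pi_star_eq_lintegral (volume.withDensity fun x => ENNReal.ofReal (f x)) (2 * r)
      (Finset.notMem_erase v _)).le.trans
      (lintegral_withDensity_closedBall_pow_le (φ := fun x => ENNReal.ofReal (f x)) (by fun_prop)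
        (fun x => ENNReal.ofReal_lt_top) (by positivity) _))
  rw [hcard, hk1] at hle
  have hM : ∫⁻ x, ENNReal.ofReal (f x) ^ k = ENNReal.ofReal (∫ x, f x ^ k) := by
    rw [ofReal_integral_eq_lintegral_ofReal hf (Eventually.of_forall fun x => pow_nonneg (h0 x) k)]
    exact lintegral_congr fun x => (ENNReal.ofReal_pow (h0 x) k).symm
  have hM0 : 0 ≤ ∫ x, f x ^ k := integral_nonneg fun x => pow_nonneg (h0 x) k
  have hVt : volume (Metric.closedBall (0 : E) 1) ≠ ∞ := measure_closedBall_lt_top.ne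
  rw [hM, Measure.addHaar_closedBall' _ _ (by positivity)] at hle
  rw [measureReal_def]
  refine (ENNReal.toReal_mono (by finiteness) hle).trans (le_of_eq ?_)
  rw [ENNReal.toReal_mul, ENNReal.toReal_mul, ENNReal.toReal_pow, ENNReal.toReal_mul,
    ENNReal.toReal_ofReal hM0, ENNReal.toReal_ofReal (by positivity), ENNReal.toReal_ofNat,
    mul_pow, mul_pow, mul_pow, mul_pow]
  ring

end StarBounds

/-! ### Weak law for normalized triple counts. -/

section WeakLaw

variable {E : Type*} [NormedAddCommGroup E] [InnerProductSpace ℝ E] [FiniteDimensional ℝ E]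
  [MeasurableSpace E] [BorelSpace E]

/-- The triples of points whose differences from the first point, scaled by `r⁻¹`, lie in `S`. -/
def scaledTriples (S : Set (E × E)) (r : ℝ) : Set (E × E × E) :=
  {p | (r⁻¹ • (p.2.1 - p.1), r⁻¹ • (p.2.2 - p.1)) ∈ S}

theorem measurableSet_scaledTriples {S : Set (E × E)} (hS : MeasurableSet S) (r : ℝ) :
    MeasurableSet (scaledTriples S r) :=
  hS.preimage (f := fun p : E × E × E => (r⁻¹ • (p.2.1 - p.1), r⁻¹ • (p.2.2 - p.1)))
    (by fun_prop)

theorem norm_inv_smul_sub_le_one_iff {E : Type*} [NormedAddCommGroup E] [NormedSpace ℝ E] {r : ℝ}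
    (hr : 0 < r) (x y : E) :
    ‖r⁻¹ • (y - x)‖ ≤ 1 ↔ dist x y ≤ r := by
  rw [norm_smul, norm_inv, Real.norm_of_nonneg hr.le, inv_mul_le_one₀ hr, dist_comm, dist_eq_norm]

/-- These are the three variance terms divided by `n⁶ρ⁴`. The first denominator is the square of
`n^(3/2) ρ`, and the second eventually dominates `n^(3/2) ρ`. -/
theorem tendsto_sum_inv_pow_atTop {ρ : ℕ → ℝ} (hρ : ∀ᶠ n in atTop, 0 < ρ n)
    (hlarge : Tendsto (fun n : ℕ => (n : ℝ) ^ (3 / 2 : ℝ) * ρ n) atTop atTop) :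
    Tendsto (fun n : ℕ => ((n : ℝ) ^ 3 * ρ n ^ 2)⁻¹ + ((n : ℝ) ^ 2 * ρ n)⁻¹ + (n : ℝ)⁻¹)
      atTop (𝓝 0) := by
  have h1 : Tendsto (fun n : ℕ => (n : ℝ) ^ 3 * ρ n ^ 2) atTop atTop := by
    refine (hlarge.atTop_mul_atTop₀ hlarge).congr fun n => ?_
    have : (n : ℝ) ^ (3 / 2 : ℝ) * (n : ℝ) ^ (3 / 2 : ℝ) = (n : ℝ) ^ 3 := by
      rw [← Real.rpow_natCast, ← Real.rpow_add_of_nonneg (by positivity) (by norm_num)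
        (by norm_num)]
      norm_num
    rw [← this]; ring
  have h2 : Tendsto (fun n : ℕ => (n : ℝ) ^ 2 * ρ n) atTop atTop := by
    refine tendsto_atTop_mono' _ ?_ hlarge
    filter_upwards [hρ, eventually_ge_atTop 1] with n hn hn1
    refine mul_le_mul_of_nonneg_right ?_ hn.le
    rw [← Real.rpow_natCast]
    exact Real.rpow_le_rpow_of_exponent_le (by exact_mod_cast hn1) (by norm_num)
  simpa using (h1.inv_tendsto_atTop.add h2.inv_tendsto_atTop).add
    (tendsto_natCast_atTop_atTop (R := ℝ)).inv_tendsto_atTop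

theorem tendsto_pi_tripleSum {f : E → ℝ} (hm : Measurable f) (h0 : ∀ x, 0 ≤ f x)
    [IsProbabilityMeasure (volume.withDensity fun x => ENNReal.ofReal (f x) : Measure E)]
    (hf : ∀ k, 3 ≤ k → k ≤ 5 → Integrable (fun x => f x ^ k) volume)
    {S : Set (E × E)} (hS : MeasurableSet S) (hS1 : ∀ q ∈ S, ‖q.1‖ ≤ 1 ∧ ‖q.2‖ ≤ 1)
    {r : ℕ → ℝ} (hr : ∀ᶠ n in atTop, 0 < r n) (hr0 : Tendsto r atTop (𝓝 0))
    (hlarge : Tendsto (fun n : ℕ => (n : ℝ) ^ (3 / 2 : ℝ) * r n ^ Module.finrank ℝ E)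
      atTop atTop) {η : ℝ} (hη : 0 < η) :
    Tendsto (fun n => (Measure.pi fun _ : Fin n =>
        (volume.withDensity fun x => ENNReal.ofReal (f x) : Measure E))
        {x | η ≤ |tripleSum (scaledTriples S (r n)) x /
          ((orderedTriples n).card * (r n ^ Module.finrank ℝ E) ^ 2) -
            volume.real S * ∫ x, f x ^ 3|}) atTop (𝓝 0) := by
  set μ : Measure E := volume.withDensity fun x => ENNReal.ofReal (f x) with hμ
  set D := Module.finrank ℝ E with hD
  set β := volume.real S * ∫ x, f x ^ 3 with hβ
  have hint0 : ∀ k : ℕ, 0 ≤ ∫ x, f x ^ k := fun k =>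
    integral_nonneg fun x => pow_nonneg (h0 x) k
  have hSt : volume S ≠ ∞ := by
    refine ne_top_of_le_ne_top ?_ (measure_mono (t :=
      Metric.closedBall (0 : E) 1 ×ˢ Metric.closedBall (0 : E) 1) fun q hq => ?_)
    · rw [Measure.volume_eq_prod, Measure.prod_prod]
      exact ENNReal.mul_ne_top measure_closedBall_lt_top.ne measure_closedBall_lt_top.ne
    · simpa using hS1 q hq
  have hmean : Tendsto (fun n => (μ.prod (μ.prod μ)).real (scaledTriples S (r n)) /
      (r n ^ D) ^ 2) atTop (𝓝 β) := by
    have h := (ENNReal.tendsto_toReal (ENNReal.mul_ne_top hSt ENNReal.ofReal_ne_top)).comp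
      (tendsto_prod_prod_withDensity_scaled hm h0 (hf 3 le_rfl (by norm_num)) hS hSt hr hr0)
    rw [ENNReal.toReal_mul, ENNReal.toReal_ofReal (hint0 3)] at h
    refine h.congr' ?_
    filter_upwards [hr] with n hn
    simp only [Function.comp_apply]
    rw [ENNReal.toReal_div, ENNReal.toReal_pow, ENNReal.toReal_ofReal (by positivity)]
    rfl
  set A : ℝ := 2 ^ D * (volume (Metric.closedBall (0 : E) 1)).toReal with hA
  have hA0 : 0 ≤ A := by positivity
  -- Summing the star constants over the possible union sizes gives one constant valid for all of
  -- them.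
  set C : ℝ := ∑ k ∈ ({3, 4, 5} : Finset ℕ), 2 * A ^ (k - 1) * ∫ x, f x ^ k with hC
  have hCk : ∀ k, 0 ≤ 2 * A ^ (k - 1) * ∫ x, f x ^ k := fun k =>
    mul_nonneg (by positivity) (hint0 k)
  have hC0 : 0 ≤ C := Finset.sum_nonneg fun k _ => hCk k
  have hvar : ∀ n, 0 < r n → variance (tripleSum (scaledTriples S (r n)))
      (Measure.pi fun _ : Fin n => μ) ≤ 15625 * C * ((n : ℝ) ^ 3 * (r n ^ D) ^ 2 +
        n ^ 4 * (r n ^ D) ^ 3 + n ^ 5 * (r n ^ D) ^ 4) := by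
    intro n hn
    refine variance_tripleSum_le μ (measurableSet_scaledTriples hS _) (by positivity) hC0
      fun s hs t ht hst => ?_
    have hc3 : 3 ≤ (tripleSupport s ∪ tripleSupport t).card := by
      rw [← card_tripleSupport hs]; exact Finset.card_le_card Finset.subset_union_left
    have hc5 : (tripleSupport s ∪ tripleSupport t).card ≤ 5 := by
      have h1 := Finset.card_union_add_card_inter (tripleSupport s) (tripleSupport t)
      have h2 : 0 < (tripleSupport s ∩ tripleSupport t).card :=
        Finset.card_pos.2 (Finset.not_disjoint_iff_nonempty_inter.1 hst)
      have h3 := card_tripleSupport hs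
      have h4 := card_tripleSupport ht
      omega
    refine (pi_real_tripleEval_inter_le hm h0 (hf _ hc3 hc5) hn (fun p hp => ?_) hst rfl).trans ?_
    · have := hS1 _ hp
      rwa [norm_inv_smul_sub_le_one_iff hn, norm_inv_smul_sub_le_one_iff hn] at this
    · refine mul_le_mul_of_nonneg_right ?_ (by positivity)
      refine Finset.single_le_sum (f := fun k => 2 * A ^ (k - 1) * ∫ x, f x ^ k)
        (fun k _ => hCk k) ?_
      simp only [Finset.mem_insert, Finset.mem_singleton]
      omega
  have hρ : ∀ᶠ n in atTop, 0 < r n ^ D := hr.mono fun n hn => pow_pos hn D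
  have hbound := (tendsto_sum_inv_pow_atTop hρ hlarge).const_mul
    (15625 * C * 729 ^ 2 * (η / 2)⁻¹ ^ 2)
  rw [mul_zero] at hbound
  have hbound' := ENNReal.tendsto_ofReal hbound
  rw [ENNReal.ofReal_zero] at hbound'
  refine tendsto_of_tendsto_of_tendsto_of_le_of_le' tendsto_const_nhds hbound'
    (Eventually.of_forall fun n => zero_le) ?_
  filter_upwards [hr, eventually_ge_atTop 3,
    (Metric.tendsto_nhds.1 hmean) (η / 2) (by positivity)] with n hn hn3 hclose
  set ρ := r n ^ D with hρdef
  have hρ0 : 0 < ρ := pow_pos hn D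
  have hn0 : (0 : ℝ) < n := by positivity
  set M : ℝ := ((orderedTriples n).card : ℝ) with hM
  have hMn : (n : ℝ) ^ 3 / 729 ≤ M := pow_three_div_le_card_orderedTriples hn3
  have hM0 : 0 < M := lt_of_lt_of_le (by positivity) hMn
  have hB := measurableSet_scaledTriples hS (r n)
  -- The normalized mean is already within `η / 2` of `β`, so the other half must come from the
  -- fluctuation, to which Chebyshev applies.
  have hsub : {x : Fin n → E | η ≤ |tripleSum (scaledTriples S (r n)) x / (M * ρ ^ 2) - β|} ⊆
      {x | η / 2 * (M * ρ ^ 2) ≤ |tripleSum (scaledTriples S (r n)) x -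
        ∫ y, tripleSum (scaledTriples S (r n)) y ∂(Measure.pi fun _ : Fin n => μ)|} := by
    intro x hx
    simp only [Set.mem_ofPred_eq] at hx ⊢
    rw [integral_tripleSum μ hB, ← hM]
    set b := (μ.prod (μ.prod μ)).real (scaledTriples S (r n))
    rw [Real.dist_eq] at hclose
    have h1 : tripleSum (scaledTriples S (r n)) x - M * b =
        (tripleSum (scaledTriples S (r n)) x / (M * ρ ^ 2) - b / ρ ^ 2) * (M * ρ ^ 2) := by
      field_simp
    rw [h1, abs_mul, abs_of_pos (show 0 < M * ρ ^ 2 by positivity)]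
    refine mul_le_mul_of_nonneg_right ?_ (by positivity)
    have h2 := abs_sub_le (tripleSum (scaledTriples S (r n)) x / (M * ρ ^ 2)) (b / ρ ^ 2) β
    linarith
  refine (measure_mono hsub).trans ((meas_ge_le_variance_div_sq (memLp_tripleSum μ hB)
    (by positivity)).trans (ENNReal.ofReal_le_ofReal ?_))
  rw [div_le_iff₀ (by positivity)]
  refine (hvar n hn).trans ?_
  have hsq : ((n : ℝ) ^ 3 / 729) ^ 2 ≤ M ^ 2 := by gcongr
  calc 15625 * C * ((n : ℝ) ^ 3 * ρ ^ 2 + n ^ 4 * ρ ^ 3 + n ^ 5 * ρ ^ 4)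
      = 15625 * C * 729 ^ 2 * (((n : ℝ) ^ 3 * ρ ^ 2)⁻¹ + ((n : ℝ) ^ 2 * ρ)⁻¹ + (n : ℝ)⁻¹) *
          (((n : ℝ) ^ 3 / 729) ^ 2 * ρ ^ 4) := by field_simp
    _ ≤ 15625 * C * 729 ^ 2 * (((n : ℝ) ^ 3 * ρ ^ 2)⁻¹ + ((n : ℝ) ^ 2 * ρ)⁻¹ + (n : ℝ)⁻¹) *
          (M ^ 2 * ρ ^ 4) := by gcongr
    _ = _ := by field_simp

end WeakLaw

/-! ### Invariance under an independent random relabelling. -/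

section Relabelling

variable {E : Type*} [MeasurableSpace E]

theorem measurePreserving_comp_equiv {n : ℕ} (μ : Measure E) [IsProbabilityMeasure μ]
    (e : Equiv.Perm (Fin n)) :
    MeasurePreserving (fun (x : Fin n → E) i => x (e i)) (Measure.pi fun _ => μ)
      (Measure.pi fun _ => μ) := by
  have hm : Measurable fun (x : Fin n → E) i => x (e i) :=
    measurable_pi_lambda _ fun i => measurable_pi_apply _
  refine ⟨hm, Eq.symm (Measure.pi_eq fun s hs => ?_)⟩
  rw [Measure.map_apply hm (MeasurableSet.univ_pi hs)]
  have : (fun (x : Fin n → E) i => x (e i)) ⁻¹' Set.univ.pi s =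
      Set.univ.pi fun j => s (e.symm j) := by
    ext x
    simp only [Set.mem_preimage, Set.mem_pi, Set.mem_univ, true_imp_iff]
    exact ⟨fun h j => by simpa using h (e.symm j), fun h i => by simpa using h (e i)⟩
  rw [this, Measure.pi_pi]
  exact Fintype.prod_equiv e.symm _ _ fun _ => rfl

/-- Conditionally on the permutation the sample is a fixed rearrangement of i.i.d. points, so its
law is unchanged; the distribution of `σ` plays no role. -/
theorem hasLaw_relabelled {Ω : Type*} [MeasurableSpace Ω] {P : Measure Ω}
    [IsProbabilityMeasure P] {n : ℕ} {μ : Measure E} [IsProbabilityMeasure μ]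
    {X : Fin n → Ω → E} (hX : ∀ i, HasLaw (X i) μ P) (hind : iIndepFun X P)
    {σ : Ω → Equiv.Perm (Fin n)} (hσ : Measurable fun ω => (σ ω : Fin n → Fin n))
    (hσX : IndepFun (fun ω i => X i ω) (fun ω => (σ ω : Fin n → Fin n)) P) :
    HasLaw (fun ω i => X (σ ω i) ω) (Measure.pi fun _ => μ) P := by
  have hpi : HasLaw (fun ω i => X i ω) (Measure.pi fun _ => μ) P := hind.hasLaw_pi hX
  have hprod := (indepFun_iff_map_prod_eq_prod_map_map hpi.aemeasurable hσ.aemeasurable).1 hσX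
  rw [hpi.map_eq] at hprod
  set ν := P.map fun ω => (σ ω : Fin n → Fin n) with hν
  have : IsProbabilityMeasure ν := Measure.isProbabilityMeasure_map hσ.aemeasurable
  let Φ : (Fin n → E) × (Fin n → Fin n) → Fin n → E := fun p i => p.1 (p.2 i)
  have hΦ : Measurable Φ := measurable_from_prod_countable_left fun s =>
    measurable_pi_lambda _ fun i => measurable_pi_apply _
  have hpair : AEMeasurable (fun ω => ((fun i => X i ω), (σ ω : Fin n → Fin n))) P :=
    hpi.aemeasurable.prodMk hσ.aemeasurable
  refine ⟨hΦ.comp_aemeasurable hpair, ?_⟩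
  have hmap : P.map (fun ω i => X (σ ω i) ω) = ((Measure.pi fun _ => μ).prod ν).map Φ := by
    rw [← hprod, AEMeasurable.map_map_of_aemeasurable hΦ.aemeasurable hpair]
    rfl
  rw [hmap]
  ext A hA
  rw [Measure.map_apply hΦ hA, Measure.prod_apply_symm (hΦ hA)]
  -- The law `ν` lives on all self-maps, so it must be recorded that it charges only bijections.
  have hbij : ∀ᵐ s ∂ν, Function.Bijective s := by
    rw [hν, ae_map_iff hσ.aemeasurable (Set.toFinite _).measurableSet]
    exact Eventually.of_forall fun ω => (σ ω).bijective
  have hconst : ∀ᵐ s ∂ν, (Measure.pi fun _ => μ) ((fun x => (x, s)) ⁻¹' (Φ ⁻¹' A)) =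
      (Measure.pi fun _ => μ) A := by
    filter_upwards [hbij] with s hs
    exact (measurePreserving_comp_equiv μ (Equiv.ofBijective s hs)).measure_preimage
      hA.nullMeasurableSet
  rw [lintegral_congr_ae hconst, lintegral_const, measure_univ, mul_one]

theorem geomGraph_comap_perm {d n : ℕ} (r : ℝ) (x : Fin n → EuclideanSpace ℝ (Fin d))
    (e : Equiv.Perm (Fin n)) :
    (geomGraph r x).comap e = geomGraph r fun i => x (e i) := by
  ext i j
  simp [geomGraph]

end Relabelling

/-! ### Convergence of the global ratio. -/

section GlobalRatio

/-- The pairs in the unit ball. -/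
def cherrySet (d : ℕ) : Set (EuclideanSpace ℝ (Fin d) × EuclideanSpace ℝ (Fin d)) :=
  {q | ‖q.1‖ ≤ 1 ∧ ‖q.2‖ ≤ 1}

/-- The pairs in the unit ball at mutual distance at most one. -/
def triangleSet (d : ℕ) : Set (EuclideanSpace ℝ (Fin d) × EuclideanSpace ℝ (Fin d)) :=
  {q | ‖q.1‖ ≤ 1 ∧ ‖q.2‖ ≤ 1 ∧ ‖q.1 - q.2‖ ≤ 1}

theorem measurableSet_cherrySet (d : ℕ) : MeasurableSet (cherrySet d) :=
  measurableSet_norms (fun a b _ => a ≤ 1 ∧ b ≤ 1) (by measurability)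

theorem measurableSet_triangleSet (d : ℕ) : MeasurableSet (triangleSet d) :=
  measurableSet_norms (fun a b c => a ≤ 1 ∧ b ≤ 1 ∧ c ≤ 1) (by measurability)

theorem cherrySet_eq (d : ℕ) : cherrySet d = Metric.closedBall 0 1 ×ˢ Metric.closedBall 0 1 := by
  ext q
  simp [cherrySet]

theorem volume_real_cherrySet_pos (d : ℕ) : 0 < volume.real (cherrySet d) := by
  rw [cherrySet_eq, Measure.volume_eq_prod, measureReal_prod_prod]
  have : 0 < volume.real (Metric.closedBall (0 : EuclideanSpace ℝ (Fin d)) 1) :=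
    ENNReal.toReal_pos (Metric.measure_closedBall_pos volume 0 one_pos).ne'
      measure_closedBall_lt_top.ne
  positivity

theorem volume_real_triangleSet (d : ℕ) :
    volume.real (triangleSet d) = ballConst d * volume.real (cherrySet d) := by
  have : 0 < volume.real (Metric.closedBall (0 : EuclideanSpace ℝ (Fin d)) 1) :=
    ENNReal.toReal_pos (Metric.measure_closedBall_pos volume 0 one_pos).ne'
      measure_closedBall_lt_top.ne
  rw [cherrySet_eq, Measure.volume_eq_prod, measureReal_prod_prod, ballConst_eq,
    ENNReal.toReal_mul, ENNReal.toReal_mul, ENNReal.toReal_inv, ← measureReal_def,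
    ← measureReal_def, ← Measure.volume_eq_prod]
  change _ = _ * (_ * volume.real (triangleSet d)) * _
  field_simp

theorem edgeInd_geomGraph {d n : ℕ} (r : ℝ) (x : Fin n → EuclideanSpace ℝ (Fin d)) {i j : Fin n}
    (hij : i ≠ j) [Decidable (dist (x i) (x j) ≤ r)] :
    edgeInd (geomGraph r x) i j = if dist (x i) (x j) ≤ r then 1 else 0 := by
  simp [edgeInd, geomGraph, hij]

/-- Indices of an ordered triple are distinct, so adjacency is just the distance condition; taking
`x k` as origin turns cherries and triangles into the two model sets. -/
theorem globalRatio_geomGraph {d n : ℕ} {r : ℝ} (hr : 0 < r)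
    (x : Fin n → EuclideanSpace ℝ (Fin d)) :
    globalRatio (geomGraph r x) = tripleSum (scaledTriples (triangleSet d) r) x /
      tripleSum (scaledTriples (cherrySet d) r) x := by
  classical
  have hdiff : ∀ a b c : EuclideanSpace ℝ (Fin d),
      ‖r⁻¹ • (b - a) - r⁻¹ • (c - a)‖ ≤ 1 ↔ dist b c ≤ r := fun a b c => by
    rw [← norm_inv_smul_sub_le_one_iff hr, ← smul_sub, sub_sub_sub_cancel_right, norm_smul,
      norm_smul, norm_sub_rev]
  rw [globalRatio, sum_Ioi_eq_sum_orderedTriples, sum_Ioi_eq_sum_orderedTriples]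
  unfold tripleSum
  congr 1 <;> refine Finset.sum_congr rfl fun t ht => ?_ <;> rw [mem_orderedTriples] at ht
  · have h : x ∈ tripleEval t ⁻¹' scaledTriples (triangleSet d) r ↔
        dist (x t.2.2) (x t.1) ≤ r ∧ dist (x t.2.2) (x t.2.1) ≤ r ∧ dist (x t.1) (x t.2.1) ≤ r := by
      simp only [Set.mem_preimage, tripleEval, scaledTriples, triangleSet, Set.mem_ofPred_eq,
        norm_inv_smul_sub_le_one_iff hr, hdiff]
    rw [edgeInd_geomGraph _ _ (ht.1.trans ht.2).ne', edgeInd_geomGraph _ _ ht.2.ne',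
      edgeInd_geomGraph _ _ ht.1.ne, Set.indicator_apply, h]
    split_ifs <;> simp_all
  · have h : x ∈ tripleEval t ⁻¹' scaledTriples (cherrySet d) r ↔
        dist (x t.2.2) (x t.1) ≤ r ∧ dist (x t.2.2) (x t.2.1) ≤ r := by
      simp only [Set.mem_preimage, tripleEval, scaledTriples, cherrySet, Set.mem_ofPred_eq,
        norm_inv_smul_sub_le_one_iff hr]
    rw [edgeInd_geomGraph _ _ (ht.1.trans ht.2).ne', edgeInd_geomGraph _ _ ht.2.ne',
      Set.indicator_apply, h]
    split_ifs <;> simp_all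

theorem exists_forall_abs_div_sub_lt {a b : ℝ} (hb : b ≠ 0) {ε : ℝ} (hε : 0 < ε) :
    ∃ η > 0, ∀ u v : ℝ, |u - a| < η → |v - b| < η → |u / v - a / b| < ε := by
  have hc : ContinuousAt (fun p : ℝ × ℝ => p.1 / p.2) (a, b) :=
    continuousAt_fst.div continuousAt_snd hb
  obtain ⟨η, hη, h⟩ := Metric.continuousAt_iff.1 hc ε hε
  refine ⟨η, hη, fun u v hu hv => ?_⟩
  have := @h (u, v) (by rw [Prod.dist_eq]; exact max_lt hu hv)
  rwa [Real.dist_eq] at this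

theorem tendsto_pi_globalRatio {d : ℕ} {f : EuclideanSpace ℝ (Fin d) → ℝ} (hm : Measurable f)
    (h0 : ∀ x, 0 ≤ f x)
    [IsProbabilityMeasure
      (volume.withDensity fun x => ENNReal.ofReal (f x) : Measure (EuclideanSpace ℝ (Fin d)))]
    (hf : ∀ k, 3 ≤ k → k ≤ 5 → Integrable (fun x => f x ^ k) volume)
    {r : ℕ → ℝ} (hr : ∀ᶠ n in atTop, 0 < r n) (hr0 : Tendsto r atTop (𝓝 0))
    (hlarge : Tendsto (fun n : ℕ => (n : ℝ) ^ (3 / 2 : ℝ) * r n ^ d) atTop atTop)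
    {ε : ℝ} (hε : 0 < ε) :
    Tendsto (fun n => (Measure.pi fun _ : Fin n =>
        (volume.withDensity fun x => ENNReal.ofReal (f x) : Measure (EuclideanSpace ℝ (Fin d))))
        {x | ε ≤ |globalRatio (geomGraph (r n) x) - ballConst d|}) atTop (𝓝 0) := by
  set μ : Measure (EuclideanSpace ℝ (Fin d)) := volume.withDensity fun x => ENNReal.ofReal (f x)
    with hμ
  -- Otherwise `f` vanishes almost everywhere, contradicting total mass one. Positivity keeps the
  -- limiting denominator away from zero.
  have hK : 0 < ∫ x, f x ^ 3 := by
    refine lt_of_le_of_ne (integral_nonneg fun x => pow_nonneg (h0 x) 3) fun h => ?_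
    have h1 := (integral_eq_zero_iff_of_nonneg (fun x => pow_nonneg (h0 x) 3)
      (hf 3 le_rfl (by norm_num))).1 h.symm
    have h2 : (fun x => ENNReal.ofReal (f x)) =ᵐ[volume] 0 := by
      filter_upwards [h1] with x hx
      have : f x = 0 := pow_eq_zero_iff (by norm_num) |>.1 hx
      simp [this]
    have h3 : μ Set.univ = 0 := by
      rw [hμ, withDensity_congr_ae h2, withDensity_zero]
      rfl
    rw [measure_univ] at h3
    exact one_ne_zero h3
  set K := ∫ x, f x ^ 3
  have hb : volume.real (cherrySet d) * K ≠ 0 := (mul_pos (volume_real_cherrySet_pos d) hK).ne'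
  have hw : volume.real (triangleSet d) * K / (volume.real (cherrySet d) * K) = ballConst d := by
    have := volume_real_cherrySet_pos d
    rw [volume_real_triangleSet]
    field_simp
  obtain ⟨η, hη, hclose⟩ := exists_forall_abs_div_sub_lt
    (a := volume.real (triangleSet d) * K) hb hε
  rw [hw] at hclose
  have hfin : Module.finrank ℝ (EuclideanSpace ℝ (Fin d)) = d := finrank_euclideanSpace_fin
  have hN := tendsto_pi_tripleSum hm h0 hf (measurableSet_triangleSet d)
    (fun q hq => ⟨hq.1, hq.2.1⟩) hr hr0 (by rwa [hfin]) hη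
  have hD := tendsto_pi_tripleSum hm h0 hf (measurableSet_cherrySet d)
    (fun q hq => hq) hr hr0 (by rwa [hfin]) hη
  have hsum := hN.add hD
  rw [add_zero] at hsum
  refine tendsto_of_tendsto_of_tendsto_of_le_of_le' tendsto_const_nhds hsum
    (Eventually.of_forall fun n => zero_le) ?_
  filter_upwards [hr, eventually_ge_atTop 3] with n hn hn3
  refine le_trans (measure_mono fun x hx => ?_) (measure_union_le _ _)
  by_contra hcon
  simp only [Set.mem_union, Set.mem_ofPred_eq, not_or, not_le] at hcon hx
  have hM : 0 < ((orderedTriples n).card : ℝ) :=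
    lt_of_lt_of_le (by positivity) (pow_three_div_le_card_orderedTriples hn3)
  have h := hclose _ _ hcon.1 hcon.2
  rw [div_div_div_cancel_right₀ (by positivity), ← globalRatio_geomGraph hn] at h
  exact absurd hx (not_le.2 h)

/-- Pointwise `f ^ k ≤ f + f ^ 5`, by cases on `f ≤ 1`. -/
theorem integrable_pow_of_integrable_pow_five {E : Type*} [MeasurableSpace E] {ν : Measure E}
    {f : E → ℝ} (hm : Measurable f) (h0 : ∀ x, 0 ≤ f x) (h1 : Integrable f ν)
    (h5 : Integrable (fun x => f x ^ 5) ν) {k : ℕ} (hk1 : 1 ≤ k) (hk5 : k ≤ 5) :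
    Integrable (fun x => f x ^ k) ν := by
  refine (h1.add h5).mono' (by fun_prop) (Eventually.of_forall fun x => ?_)
  rw [Real.norm_of_nonneg (pow_nonneg (h0 x) k), Pi.add_apply]
  rcases le_total (f x) 1 with h | h
  · have := pow_le_of_le_one (h0 x) h (Nat.one_le_iff_ne_zero.1 hk1)
    linarith [pow_nonneg (h0 x) 5]
  · have := pow_le_pow_right₀ h hk5
    linarith [h0 x]

end GlobalRatio

/-! ### The main theorem. -/

theorem theorem5 {Ω : Type*} [MeasurableSpace Ω] (P : Measure Ω) [IsProbabilityMeasure P]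
    (d : ℕ) (hd : 1 ≤ d)
    (f : EuclideanSpace ℝ (Fin d) → ℝ) (hf_meas : Measurable f) (hf_nonneg : ∀ x, 0 ≤ f x)
    (hf5 : Integrable (fun x => f x ^ 5) volume)
    (X : (n : ℕ) → Fin n → Ω → EuclideanSpace ℝ (Fin d))
    (hX_law : ∀ n i, HasLaw (X n i) (volume.withDensity fun x => ENNReal.ofReal (f x)) P)
    (hX_indep : ∀ n, iIndepFun (X n) P)
    (σ : (n : ℕ) → Ω → Equiv.Perm (Fin n))
    (hσ_meas : ∀ n, Measurable fun ω => (σ n ω : Fin n → Fin n))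
    (hσ_indep : ∀ n, IndepFun (fun ω i => X n i ω) (fun ω => (σ n ω : Fin n → Fin n)) P)
    (r : ℕ → ℝ) (hr_nonneg : ∀ n, 0 ≤ r n) (hr_zero : Tendsto r atTop (𝓝 0))
    (hr_large : Tendsto (fun n : ℕ => (n : ℝ) ^ (3 / 2 : ℝ) * r n ^ d) atTop atTop) :
    TendstoInMeasure P
      (fun n ω => globalRatio ((geomGraph (r n) fun i => X n i ω).comap (σ n ω)))
      atTop (fun _ => ballConst d) ∧
    ∀ Δ : (n : ℕ) → SimpleGraph (Fin n) → ℕ, IsArgminDimEstimator Δ →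
      TendstoInMeasure P
        (fun n ω => (Δ n ((geomGraph (r n) fun i => X n i ω).comap (σ n ω)) : ℝ))
        atTop (fun _ => (d : ℝ)) := by
  set μ : Measure (EuclideanSpace ℝ (Fin d)) := volume.withDensity fun x => ENNReal.ofReal (f x)
    with hμ
  have hμp : IsProbabilityMeasure μ := (hX_law 1 0).isProbabilityMeasure_iff.1 inferInstance
  have hf1 : Integrable f volume := by
    refine ⟨hf_meas.aestronglyMeasurable, ?_⟩
    rw [hasFiniteIntegral_iff_ofReal (Eventually.of_forall hf_nonneg)]
    have h := measure_univ (μ := μ)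
    rw [hμ, withDensity_apply _ MeasurableSet.univ, Measure.restrict_univ] at h
    rw [h]
    exact ENNReal.one_lt_top
  have hf : ∀ k, 3 ≤ k → k ≤ 5 → Integrable (fun x => f x ^ k) volume := fun k h3 h5 =>
    integrable_pow_of_integrable_pow_five hf_meas hf_nonneg hf1 hf5 (by omega) h5
  -- A zero radius would make `n^(3/2) r^d` vanish, as `d ≥ 1`.
  have hr : ∀ᶠ n in atTop, 0 < r n := by
    filter_upwards [hr_large.eventually_gt_atTop 0] with n hn
    refine (hr_nonneg n).lt_of_ne fun h => ?_
    rw [← h, zero_pow (by omega), mul_zero] at hn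
    exact lt_irrefl _ hn
  have hW : ∀ ε : ℝ, 0 < ε → Tendsto (fun n => P {ω | ε ≤
      |globalRatio ((geomGraph (r n) fun i => X n i ω).comap (σ n ω)) - ballConst d|})
      atTop (𝓝 0) := by
    intro ε hε
    refine (tendsto_pi_globalRatio hf_meas hf_nonneg hf hr hr_zero hr_large hε).congr' ?_
    filter_upwards [hr] with n hn
    have hlaw := hasLaw_relabelled (hX_law n) (hX_indep n) (hσ_meas n) (hσ_indep n)
    have hmeas : ∀ S : Set (EuclideanSpace ℝ (Fin d) × EuclideanSpace ℝ (Fin d)),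
        MeasurableSet S → Measurable
          (tripleSum (scaledTriples S (r n)) : (Fin n → EuclideanSpace ℝ (Fin d)) → ℝ) :=
      fun S hS => Finset.measurable_fun_sum _ fun t _ => measurable_one.indicator
        ((measurableSet_scaledTriples hS _).preimage (measurable_tripleEval t))
    have hset : MeasurableSet {x : Fin n → EuclideanSpace ℝ (Fin d) |
        ε ≤ |globalRatio (geomGraph (r n) x) - ballConst d|} := by
      simp only [globalRatio_geomGraph hn]
      exact measurableSet_le measurable_const
        (((hmeas _ (measurableSet_triangleSet d)).div
          (hmeas _ (measurableSet_cherrySet d))).sub_const _).abs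
    rw [← hlaw.measure_eq hset]
    simp only [geomGraph_comap_perm]
  refine ⟨tendstoInMeasure_iff_norm.2 fun ε hε => hW ε hε, fun Δ hΔ => ?_⟩
  obtain ⟨δ, hδ, hiso⟩ := exists_forall_isDimArgmin_iff hd
  refine tendstoInMeasure_iff_norm.2 fun ε hε => ?_
  -- Whenever `W₂` is within `δ` of `w_d`, the unique minimizer is `d` and the estimator equals `d`
  -- exactly; so its error event lies in the deviation event of `W₂`.
  refine tendsto_of_tendsto_of_tendsto_of_le_of_le tendsto_const_nhds (hW δ hδ)
    (fun n => zero_le) fun n => measure_mono fun ω hω => ?_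
  by_contra hcon
  rw [Set.mem_ofPred_eq, not_le] at hcon
  have hmin := hiso _ hcon
  have := (hmin _).1 (hΔ n _ ⟨d, (hmin d).2 rfl⟩)
  simp only [Set.mem_ofPred_eq, this, sub_self, norm_zero] at hω
  exact absurd hε (not_lt.2 hω)
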